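/- **Setting.** Let $m,n\ge 2$, let $C\in\mathbb R_+^{n\times\cdots\times n}$ be a nonnegative tensor of order $m$ (so $n^m$ entries) with $\|C\|_\infty=\max_i|C_i|$, and let $r_1,\dots,r_m$ be probability vectors in $\mathbb R^n$. For a tensor $X$ let $[r_k(X)]_j=\sum_{i:\,i_k=j}X_{i_1\dots i_m}$ be its $k$-th marginal and $\langle C,X\rangle=\sum_i C_iX_i$. A *plan* is a nonnegative tensor $X$ with $r_k(X)=r_k$ for all $k$; an *$\varepsilon$-approximate plan* is a plan $\widehat X$ with $\langle C,\widehat X\rangle\le\langle C,X^\star\rangle+\varepsilon$, where $X^\star$ is a plan that minimizes $\langle C,\cdot\rangle$ over all plans. Let $0<\varepsilon\le 32\,m\,\|C\|_\infty$ (so $\|C\|_\infty>0$). **Algorithm.** Put $$\eta=\frac{\varepsilon}{2m\log n},\qquad \varepsilon'=\frac{\varepsilon}{8\|C\|_\infty},\qquad \tilde r_k=\Bigl(1-\frac{\varepsilon'}{4m}\Bigr)r_k+\frac{\varepsilon'}{4mn}\mathbf 1_n\quad(1\le k\le m);$$ the restriction on $\varepsilon$ says exactly that $\varepsilon'/(4m)\le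 1$, so that each $\tilde r_k$ is a probability vector. 1. *(Sinkhorn.)* For $\beta=(\beta_1,\dots,\beta_m)\in(\mathbb R^n)^m$ let $B(\beta)_{i_1\dots i_m}=\exp\bigl(\sum_k\beta_{k i_k}-C_{i_1\dots i_m}/\eta\bigr)$ and $E(\beta)=\sum_k\|r_k(B(\beta))-\tilde r_k\|_1$. Start with $\beta^0=0$. While $E(\beta^t)>\varepsilon'/2$, choose $K$ maximizing $\rho(\tilde r_k,r_k(B(\beta^t)))$ over $k$, where $\rho(a,b)=\sum_j(b_j-a_j)+\sum_j a_j\log(a_j/b_j)$ (ties broken arbitrarily), set $\beta^{t+1}_K=\beta^t_K+\log\tilde r_K-\log r_K(B(\beta^t))$ entrywise and $\beta_k^{t+1}=\beta_k^t$ for $k\neq K$. On leaving the loop put $\widetilde X=B(\beta^t)$. 2. *(Rounding to the marginals $r_k$.)* Put $X^{(0)}=\widetilde X$; for $k=1,\dots,m$ let $z_k=\min\{\mathbf 1_n,\,r_k/r_k(X^{(k-1)})\}$ entrywise and $X^{(k)}_{i_1\dots i_m}=z_{k i_k}X^{(k-1)}_{i_1\dots i_m}$. With $\mathrm{err}_k=r_k-r_k(X^{(m)})$,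 output $$\widehat X_{i_1\dots i_m}=X^{(m)}_{i_1\dots i_m}+\frac{\prod_{k=1}^m\mathrm{err}_{k i_k}}{\|\mathrm{err}_1\|_1^{m-1}},$$ the last term being read as $0$ if $\mathrm{err}_1=0$. **Theorem.** There is a universal constant $c>0$ such that for all $m,n,C,(r_k),\varepsilon$ as above: * however ties are broken, the Sinkhorn loop terminates, after at most $c\,m^3\|C\|_\infty^2\log(n)\,\varepsilon^{-2}$ iterations; * every output $\widehat X$ of the algorithm is an $\varepsilon$-approximate plan (in particular it has exactly the marginals $r_k$, and an optimal plan exists); * the algorithm can be carried out with at most $$c\;\frac{m^3\,n^m\,\|C\|_\infty^2\,\log n}{\varepsilon^2}$$ arithmetic operations (additions, subtractions, multiplications, divisions, exponentials, logarithms, comparisons and loading of integer constants on real numbers, each at unit cost; indexing and storage are free). More precisely, an explicit program in this model, which computes all marginals of a tensor by summing out one index after the other and updates $B(\beta)$ by rescaling along the changed coordinate, halts within this number of operations and returns an output of the algorithm. -/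

import Mathlib

open scoped BigOperators

noncomputable section

namespace MOT

/-! ### Tensors, marginals and the multimarginal optimal transport problem -/

/-- Tensors of order `m` with all dimensions equal to `n`. -/
abbrev Tensor (m n : ℕ) (V : Type) : Type := (Fin m → Fin n) → V

/-- The `k`-th marginal `r_k(A)`: entry `j` is the sum of all `A i` with `i k = j`. -/
def marginal {m n : ℕ} (k : Fin m) (A : Tensor m n ℝ) (j : Fin n) : ℝ :=
  ∑ i : Fin m → Fin n with i k = j, A i

/-- The Frobenius inner product. -/
def frob {m n : ℕ} (A B : Tensor m n ℝ) : ℝ := ∑ i, A i * B i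

/-- Feasible points of the transport problem: nonnegative tensors with marginals `r`. -/
def IsPlan {m n : ℕ} (r : Fin m → Fin n → ℝ) (X : Tensor m n ℝ) : Prop :=
  (∀ i, 0 ≤ X i) ∧ ∀ k, marginal k X = r k

/-- Optimal multimarginal transportation plans. -/
def IsOptimalPlan {m n : ℕ} (C : Tensor m n ℝ) (r : Fin m → Fin n → ℝ)
    (X : Tensor m n ℝ) : Prop :=
  IsPlan r X ∧ ∀ Y, IsPlan r Y → frob C X ≤ frob C Y

/-- `ε`-approximate multimarginal transportation plans. -/
def IsApproxPlan {m n : ℕ} (C : Tensor m n ℝ) (r : Fin m → Fin n → ℝ) (ε : ℝ)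
    (X : Tensor m n ℝ) : Prop :=
  IsPlan r X ∧ ∃ Xopt, IsOptimalPlan C r Xopt ∧ frob C X ≤ frob C Xopt + ε

/-! ### Multimarginal Sinkhorn -/

/-- The tensor `B(β)`, with entries `exp (∑ k, β k (i k) - C i / η)`. -/
def gibbs {m n : ℕ} (C : Tensor m n ℝ) (η : ℝ) (β : Fin m → Fin n → ℝ) : Tensor m n ℝ :=
  fun i => Real.exp (∑ k, β k (i k) - C i / η)

/-- `ρ(a, b) = 1ᵀ(b - a) + ∑ j, a_j log (a_j / b_j)`. -/
def rho {n : ℕ} (a b : Fin n → ℝ) : ℝ :=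
  ∑ j, (b j - a j) + ∑ j, a j * Real.log (a j / b j)

/-- The residue `E = ∑ k, ‖r_k(B(β)) - r_k‖₁`. -/
def residue {m n : ℕ} (C : Tensor m n ℝ) (η : ℝ) (r : Fin m → Fin n → ℝ)
    (β : Fin m → Fin n → ℝ) : ℝ :=
  ∑ k, ∑ j, |marginal k (gibbs C η β) j - r k j|

/-- `K` is a greedy coordinate at `β`: it maximizes `ρ(r_k, r_k(B(β)))`. -/
def IsGreedy {m n : ℕ} (C : Tensor m n ℝ) (η : ℝ) (r : Fin m → Fin n → ℝ)
    (β : Fin m → Fin n → ℝ) (K : Fin m) : Prop :=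
  ∀ k, rho (r k) (marginal k (gibbs C η β)) ≤ rho (r K) (marginal K (gibbs C η β))

/-- The update of block `K`. -/
def sinkhornUpdate {m n : ℕ} (C : Tensor m n ℝ) (η : ℝ) (r : Fin m → Fin n → ℝ)
    (β : Fin m → Fin n → ℝ) (K : Fin m) : Fin m → Fin n → ℝ :=
  Function.update β K fun j =>
    β K j + Real.log (r K j) - Real.log (marginal K (gibbs C η β) j)

/-- `β 0, β 1, …` are iterates of multimarginal Sinkhorn started at `0`; ties between greedy
coordinates may be broken arbitrarily. (The stopping test is in `SinkhornReturns`.) -/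
structure IsSinkhornSeq {m n : ℕ} (C : Tensor m n ℝ) (η : ℝ) (r : Fin m → Fin n → ℝ)
    (β : ℕ → Fin m → Fin n → ℝ) : Prop where
  zero : β 0 = 0
  succ : ∀ t, ∃ K, IsGreedy C η r (β t) K ∧ β (t + 1) = sinkhornUpdate C η r (β t) K

/-- `X` is an output of multimarginal Sinkhorn with tolerance `tol`: the loop is left at the first
iterate whose residue is at most `tol`, and `X` is the tensor `B(β)` of that iterate. -/
def SinkhornReturns {m n : ℕ} (C : Tensor m n ℝ) (η : ℝ) (r : Fin m → Fin n → ℝ) (tol : ℝ)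
    (X : Tensor m n ℝ) : Prop :=
  ∃ (β : ℕ → Fin m → Fin n → ℝ) (t : ℕ), IsSinkhornSeq C η r β ∧
    (∀ s < t, tol < residue C η r (β s)) ∧ residue C η r (β t) ≤ tol ∧ X = gibbs C η (β t)

/-! ### The rounding scheme -/

/-- One scaling step `X ↦ z_k · X` along coordinate `k`, `z_k = min {1, r_k / r_k(X)}`. -/
def scale {m n : ℕ} (r : Fin m → Fin n → ℝ) (X : Tensor m n ℝ) (k : Fin m) : Tensor m n ℝ :=
  fun i => min 1 (r k (i k) / marginal k X (i k)) * X i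

/-- `X⁽ᵐ⁾`: the scaling steps for `k = 1, …, m`, in this order. -/
def scaleAll {m n : ℕ} (r : Fin m → Fin n → ℝ) (X : Tensor m n ℝ) : Tensor m n ℝ :=
  (List.finRange m).foldl (scale r) X

/-- `err_k = r_k - r_k(X⁽ᵐ⁾)`. -/
def err {m n : ℕ} (r : Fin m → Fin n → ℝ) (X : Tensor m n ℝ) (k : Fin m) (j : Fin n) : ℝ :=
  r k j - marginal k (scaleAll r X) j

/-- The rounding scheme. If `err_1 = 0` the correction term is read as `0` (this is what
division by zero gives here). -/
def round {m n : ℕ} [NeZero m] (r : Fin m → Fin n → ℝ) (X : Tensor m n ℝ) : Tensor m n ℝ :=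
  fun i => scaleAll r X i + (∏ k, err r X k (i k)) / (∑ j, |err r X 0 j|) ^ (m - 1)

/-! ### The algorithm for the transport problem -/

/-- `η = ε / (2 m log n)`. -/
def etaOf (m n : ℕ) (ε : ℝ) : ℝ := ε / (2 * m * Real.log n)

/-- `ε' = ε / (8 ‖C‖_∞)`; the norm of a tensor (a finite family of reals) is its sup norm. -/
def epsOf {m n : ℕ} (C : Tensor m n ℝ) (ε : ℝ) : ℝ := ε / (8 * ‖C‖)

/-- The smoothed marginals `(1 - ε' / (4 m)) r_k + (ε' / (4 m n)) 1`. -/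
def smoothed {m n : ℕ} (C : Tensor m n ℝ) (r : Fin m → Fin n → ℝ) (ε : ℝ)
    (k : Fin m) (j : Fin n) : ℝ :=
  (1 - epsOf C ε / (4 * m)) * r k j + epsOf C ε / (4 * m * n)

/-- `X` is an output of the algorithm: Sinkhorn on the smoothed marginals with tolerance
`ε' / 2`, then rounding to the original marginals. -/
def ApproxMOTReturns {m n : ℕ} [NeZero m] (C : Tensor m n ℝ) (r : Fin m → Fin n → ℝ) (ε : ℝ)
    (X : Tensor m n ℝ) : Prop :=
  ∃ Xs, SinkhornReturns C (etaOf m n ε) (smoothed C r ε) (epsOf C ε / 2) Xs ∧ X = round r Xs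

/-! ### A machine model that counts arithmetic operations

Programs are written over an abstract type `V` of numbers. The only way to obtain or to inspect
a number is through the constructors of `Prog`, and every one of them except `ret` costs one
operation. Reading and storing numbers and handling indices is free, as usual when arithmetic
operations are counted. -/

/-- Binary arithmetic operations. -/
inductive BinOp
  | add | sub | mul | div

/-- Unary elementary operations. -/
inductive UnOp
  | exp | log

/-- Finite (loop-free) programs over numbers of type `V` with result in `α`. -/
inductive Prog (V α : Type) : Type
  | ret (a : α) : Prog V α
  | lit (k : ℕ) (next : V → Prog V α) : Prog V α
  | bin (o : BinOp) (x y : V) (next : V → Prog V α) : Prog V α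
  | un (o : UnOp) (x : V) (next : V → Prog V α) : Prog V α
  | lt (x y : V) (next : Bool → Prog V α) : Prog V α

namespace Prog

/-- Sequential composition. -/
def bind {V α γ : Type} : Prog V α → (α → Prog V γ) → Prog V γ
  | ret a, f => f a
  | lit k next, f => lit k fun v => bind (next v) f
  | bin o x y next, f => bin o x y fun v => bind (next v) f
  | un o x next, f => un o x fun v => bind (next v) f
  | lt x y next, f => lt x y fun b => bind (next b) f

instance instMonad (V : Type) : Monad (Prog V) where
  pure := ret
  bind := bind

/-- Real semantics of binary operations. -/
def evalBin : BinOp → ℝ → ℝ → ℝ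
  | .add, x, y => x + y
  | .sub, x, y => x - y
  | .mul, x, y => x * y
  | .div, x, y => x / y

/-- Real semantics of unary operations. -/
def evalUn : UnOp → ℝ → ℝ
  | .exp, x => Real.exp x
  | .log, x => Real.log x

open Classical in
/-- Running a program over the reals: the result and the number of operations executed. -/
def eval {α : Type} : Prog ℝ α → α × ℕ
  | ret a => (a, 0)
  | lit k next => ((eval (next k)).1, (eval (next k)).2 + 1)
  | bin o x y next => ((eval (next (evalBin o x y))).1, (eval (next (evalBin o x y))).2 + 1)
  | un o x next => ((eval (next (evalUn o x))).1, (eval (next (evalUn o x))).2 + 1)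
  | lt x y next => ((eval (next (decide (x < y)))).1, (eval (next (decide (x < y)))).2 + 1)

/-- Unbounded loops: from state `s`, the body is run until it returns a result `w` instead of a
new state; `N` is the total number of operations of all passes. -/
inductive LoopHalts {σ ω : Type} (body : σ → Prog ℝ (σ ⊕ ω)) : σ → ω → ℕ → Prop
  | exit (s : σ) (w : ω) (h : (body s).eval.1 = Sum.inr w) :
      LoopHalts body s w (body s).eval.2
  | again (s s' : σ) (w : ω) (N : ℕ) (h : (body s).eval.1 = Sum.inl s')
      (hN : LoopHalts body s' w N) : LoopHalts body s w ((body s).eval.2 + N)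

/-! Basic routines -/

section Routines

variable {V : Type}

/-- The numeral `k`. -/
def num (k : ℕ) : Prog V V := lit k ret
/-- Addition. -/
def add (x y : V) : Prog V V := bin .add x y ret
/-- Subtraction. -/
def sub (x y : V) : Prog V V := bin .sub x y ret
/-- Multiplication. -/
def mul (x y : V) : Prog V V := bin .mul x y ret
/-- Division. -/
def div (x y : V) : Prog V V := bin .div x y ret
/-- Exponential. -/
def exp (x : V) : Prog V V := un .exp x ret
/-- Natural logarithm. -/
def log (x : V) : Prog V V := un .log x ret
/-- The comparison `x < y`. -/
def less (x y : V) : Prog V Bool := lt x y ret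

/-- Minimum of two numbers. -/
def minP (x y : V) : Prog V V := do
  let b ← less x y
  return if b then x else y

/-- Maximum of two numbers. -/
def maxP (x y : V) : Prog V V := do
  let b ← less x y
  return if b then y else x

/-- Absolute value. -/
def absP (x : V) : Prog V V := do
  let z ← num 0
  let y ← sub z x
  maxP x y

/-- Run `f 0, f 1, …` and collect the results in a vector. -/
def tab {α : Type} : {k : ℕ} → (Fin k → Prog V α) → Prog V (Fin k → α)
  | 0, _ => return Fin.elim0
  | _ + 1, f => do
    let a ← f 0
    let v ← tab fun j => f j.succ
    return Fin.cons a v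

/-- Run `f i` for all multi-indices `i` and collect the results in a tensor. -/
def tabT {n : ℕ} {α : Type} : {m : ℕ} → ((Fin m → Fin n) → Prog V α) → Prog V (Tensor m n α)
  | 0, f => do
    let a ← f Fin.elim0
    return fun _ => a
  | _ + 1, f => do
    let rows ← tab fun j => tabT fun i => f (Fin.cons j i)
    return fun i => rows (i 0) (Fin.tail i)

/-- Sum of a vector. -/
def sumV : {k : ℕ} → (Fin k → V) → Prog V V
  | 0, _ => num 0
  | _ + 1, v => do
    let s ← sumV (Fin.tail v)
    add (v 0) s

/-- Product of a vector. -/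
def prodV : {k : ℕ} → (Fin k → V) → Prog V V
  | 0, _ => num 1
  | _ + 1, v => do
    let s ← prodV (Fin.tail v)
    mul (v 0) s

/-- Largest entry of a vector of nonnegative numbers (`0` for the empty vector). -/
def maxV : {k : ℕ} → (Fin k → V) → Prog V V
  | 0, _ => num 0
  | _ + 1, v => do
    let s ← maxV (Fin.tail v)
    maxP (v 0) s

/-- `ℓ₁` norm of a vector. -/
def normV {k : ℕ} (v : Fin k → V) : Prog V V := do
  let a ← tab fun j => absP (v j)
  sumV a

/-- Sum of all entries of a tensor. -/
def sumT {n : ℕ} : {m : ℕ} → Tensor m n V → Prog V V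
  | 0, A => return A Fin.elim0
  | _ + 1, A => do
    let v ← tab fun j => sumT fun i => A (Fin.cons j i)
    sumV v

/-- Largest absolute value of an entry of a tensor. -/
def normT {n : ℕ} : {m : ℕ} → Tensor m n V → Prog V V
  | 0, A => absP (A Fin.elim0)
  | _ + 1, A => do
    let v ← tab fun j => normT fun i => A (Fin.cons j i)
    maxV v

/-- All marginals of a tensor: the first one by summation of its slices, the others as the
marginals of the smaller tensor that results from summing out the first index. -/
def marginals {n : ℕ} : {m : ℕ} → Tensor m n V → Prog V (Fin m → Fin n → V)
  | 0, _ => return Fin.elim0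
  | m + 1, A => do
    let q ← tab fun j => sumT (m := m) fun i => A (Fin.cons j i)
    let A' ← tabT fun i : Fin m → Fin n => sumV fun j => A (Fin.cons j i)
    let qs ← marginals A'
    return Fin.cons q qs

/-- The first index at which a vector attains its maximum. -/
def argmax {m : ℕ} [NeZero m] (v : Fin m → V) : Prog V (Fin m) :=
  (List.finRange m).foldlM (fun K k => do
    let b ← less (v K) (v k)
    return if b then k else K) 0

/-- The function `ρ`. -/
def rhoP {n : ℕ} (a b : Fin n → V) : Prog V V := do
  let d ← tab fun j => sub (b j) (a j)
  let D ← sumV d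
  let e ← tab fun j => do
    let q ← div (a j) (b j)
    let l ← log q
    mul (a j) l
  let T ← sumV e
  add D T

end Routines

/-! The implementation of the algorithm -/

/-- The state of the Sinkhorn loop: smoothed marginals, tolerance, dual variables `β` and the
tensor `B(β)`. -/
structure State (m n : ℕ) (V : Type) where
  rs : Fin m → Fin n → V
  tol : V
  β : Fin m → Fin n → V
  B : Tensor m n V

section Algorithm

variable {V : Type} {m n : ℕ}

/-- Parameters, smoothed marginals, and the Sinkhorn initialization. -/
def initP (C : Tensor m n V) (r : Fin m → Fin n → V) (ε : V) : Prog V (State m n V) := do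
  let zero ← num 0
  let one ← num 1
  let two ← num 2
  let four ← num 4
  let eight ← num 8
  let mV ← num m
  let nV ← num n
  let logn ← log nV
  let twom ← mul two mV
  let twomlog ← mul twom logn
  let eta ← div ε twomlog
  let normC ← normT C
  let normC8 ← mul eight normC
  let eps ← div ε normC8
  let tol ← div eps two
  let fourm ← mul four mV
  let w ← div eps fourm
  let u ← sub one w
  let c ← div w nV
  let rs ← tab fun k => tab fun j => do
    let x ← mul u (r k j)
    add x c
  let B ← tabT fun i => do
    let q ← div (C i) eta
    let p ← sub zero q
    exp p
  return { rs := rs, tol := tol, β := fun _ _ => zero, B := B }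

/-- One pass of the Sinkhorn loop: the stopping test, then the greedy choice and the update of
`β` and of `B(β)`. -/
def bodyP [NeZero m] (s : State m n V) : Prog V (State m n V ⊕ Tensor m n V) := do
  let q ← marginals s.B
  let e ← tab fun k => do
    let d ← tab fun j => sub (q k j) (s.rs k j)
    normV d
  let E ← sumV e
  let go ← less s.tol E
  if go then do
    let ρ ← tab fun k => rhoP (s.rs k) (q k)
    let K ← argmax ρ
    let δ ← tab fun j => do
      let x ← log (s.rs K j)
      let y ← log (q K j)
      sub x y
    let βK ← tab fun j => add (s.β K j) (δ j)
    let f ← tab fun j => exp (δ j)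
    let B' ← tabT fun i => mul (s.B i) (f (i K))
    return Sum.inl { rs := s.rs, tol := s.tol, β := Function.update s.β K βK, B := B' }
  else
    return Sum.inr s.B

/-- The rounding scheme. -/
def roundP [NeZero m] (r : Fin m → Fin n → V) (X : Tensor m n V) : Prog V (Tensor m n V) := do
  let one ← num 1
  let Xm ← (List.finRange m).foldlM (fun Y k => do
    let q ← marginals Y
    let z ← tab fun j => do
      let x ← div (r k j) (q k j)
      minP one x
    tabT fun i => mul (z (i k)) (Y i)) X
  let q ← marginals Xm
  let er ← tab fun k => tab fun j => sub (r k j) (q k j)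
  let l ← normV (er 0)
  let d ← prodV fun _ : Fin (m - 1) => l
  tabT fun i => do
    let p ← prodV fun k => er k (i k)
    let x ← div p d
    add (Xm i) x

end Algorithm

/-- The implementation, run on `C`, `r`, `ε`, halts with output `X` after exactly `N`
operations. -/
def ApproxMOTHalts {m n : ℕ} [NeZero m] (C : Tensor m n ℝ) (r : Fin m → Fin n → ℝ) (ε : ℝ)
    (X : Tensor m n ℝ) (N : ℕ) : Prop :=
  ∃ (Xs : Tensor m n ℝ) (N' : ℕ), LoopHalts bodyP (initP C r ε).eval.1 Xs N' ∧
    X = (roundP r Xs).eval.1 ∧ N = (initP C r ε).eval.2 + N' + (roundP r Xs).eval.2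

end Prog

end MOT

end

noncomputable section

namespace MOT

/-! ### Sums over multi-indices -/

/-! Iteration count. Sinkhorn is block coordinate descent on the convex function `dualObj`, whose
gradient in block k is `marginal k (gibbs C η β) - r k`. Updating block K minimizes exactly over
that block and lowers the objective by `rho (r K) (marginal K _)` (`dualObj_sub_sinkhornUpdate`).
Once a single update has been made the tensor has mass 1, so a Pinsker inequality and the greedy
choice bound the squared residue by 4m² times the decrease (`residue_sq_le`). Conversely, every
block of every iterate oscillates by at most R = ‖C‖/η + log(1/δ), where δ bounds the target
marginals below (`sinkhornUpdate_osc_le`); convexity then bounds the objective gap by 2R times the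
residue. Together these give a recursion u_t - u_{t+1} ≥ κ u_t², which is integrated through 1/u and
yields O(m²R/tol) iterations. Smoothing the marginals is what makes δ positive.

Accuracy. Rounding changes the cost by at most ‖C‖ times the ℓ₁ marginal error (`frob_round_le`). It
is used twice: on the Sinkhorn output, to reach the marginals r, and on an optimal plan, to reach
the marginals of B(β). Among nonnegative tensors with those marginals, B(β) minimizes cost plus η
times negative entropy, and entropy varies by at most mass · m log n there (`frob_gibbs_le`). With
the chosen parameters these three errors add up to less than ε.

Operations. Summing out indices successively gives all m marginals in O(n^m), since the tensors
shrink geometrically; hence each Sinkhorn pass costs O(n^m). Rounding costs O(m n^m), which is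
absorbed because ε ≤ 32 m ‖C‖ forces m to be at most a constant times the iteration bound
(`le_complexity`). -/

theorem sum_cons {m n : ℕ} (F : (Fin (m + 1) → Fin n) → ℝ) :
    ∑ i, F i = ∑ j, ∑ i : Fin m → Fin n, F (Fin.cons j i) := by
  rw [← (Fin.consEquiv fun _ : Fin (m + 1) => Fin n).sum_comp, Fintype.sum_prod_type]
  rfl

theorem marginal_eq_ite {m n : ℕ} (k : Fin m) (A : Tensor m n ℝ) (j : Fin n) :
    marginal k A j = ∑ i, if i k = j then A i else 0 := by
  rw [marginal, Finset.sum_filter]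

theorem marginal_zero {m n : ℕ} (A : Tensor (m + 1) n ℝ) (j : Fin n) :
    marginal 0 A j = ∑ i : Fin m → Fin n, A (Fin.cons j i) := by
  rw [marginal_eq_ite, sum_cons, Finset.sum_eq_single j]
  · simp
  · intro b _ hb
    simp [hb]
  · simp

/-- The recursion on which `marginals` rests. -/
theorem marginal_succ {m n : ℕ} (A : Tensor (m + 1) n ℝ) (k : Fin m) :
    marginal k.succ A = marginal k fun i : Fin m → Fin n => ∑ j, A (Fin.cons j i) := by
  funext j
  rw [marginal_eq_ite, sum_cons, Finset.sum_comm, marginal_eq_ite]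
  refine Finset.sum_congr rfl fun i _ => ?_
  by_cases h : i k = j <;> simp [h]

namespace Prog

/-! ### Semantics and costs of the routines -/

section Eval

variable {α γ : Type}

@[simp] theorem eval_pure (a : α) : (pure a : Prog ℝ α).eval = (a, 0) := rfl

@[simp] theorem eval_bind (p : Prog ℝ α) (f : α → Prog ℝ γ) :
    (p >>= f).eval = ((f p.eval.1).eval.1, p.eval.2 + (f p.eval.1).eval.2) := by
  change (bind p f).eval = _
  induction p with
  | ret a => simp [bind, eval]
  | lit k next ih => simp only [bind, eval, ih]; ext <;> simp; omega
  | bin o x y next ih => simp only [bind, eval, ih]; ext <;> simp; omega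
  | un o x next ih => simp only [bind, eval, ih]; ext <;> simp; omega
  | lt x y next ih => simp only [bind, eval, ih]; ext <;> simp; omega

@[simp] theorem eval_num (k : ℕ) : (num k : Prog ℝ ℝ).eval = ((k : ℝ), 1) := rfl
@[simp] theorem eval_add (x y : ℝ) : (add x y).eval = (x + y, 1) := rfl
@[simp] theorem eval_sub (x y : ℝ) : (sub x y).eval = (x - y, 1) := rfl
@[simp] theorem eval_mul (x y : ℝ) : (mul x y).eval = (x * y, 1) := rfl
@[simp] theorem eval_div (x y : ℝ) : (div x y).eval = (x / y, 1) := rfl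
@[simp] theorem eval_exp (x : ℝ) : (exp x).eval = (Real.exp x, 1) := rfl
@[simp] theorem eval_log (x : ℝ) : (log x).eval = (Real.log x, 1) := rfl

open Classical in
@[simp] theorem eval_less (x y : ℝ) : (less x y).eval = (decide (x < y), 1) := rfl

@[simp] theorem eval_minP (x y : ℝ) : (minP x y).eval = (min x y, 1) := by
  by_cases h : x < y
  · simp [minP, h, min_eq_left h.le]
  · simp [minP, h, min_eq_right (not_lt.1 h)]

@[simp] theorem eval_maxP (x y : ℝ) : (maxP x y).eval = (max x y, 1) := by
  by_cases h : x < y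
  · simp [maxP, h, max_eq_right h.le]
  · simp [maxP, h, max_eq_left (not_lt.1 h)]

@[simp] theorem eval_absP (x : ℝ) : (absP x).eval = (|x|, 3) := by
  simp [absP, abs]

@[simp] theorem eval_tab_fst : ∀ {k : ℕ} (f : Fin k → Prog ℝ α),
    (tab f).eval.1 = fun j => (f j).eval.1
  | 0, _ => funext fun j => j.elim0
  | _ + 1, f => by
    funext j
    simp only [tab, eval_bind, eval_pure, eval_tab_fst]
    refine Fin.cases ?_ (fun j => ?_) j <;> simp

theorem eval_tab_snd_le : ∀ {k : ℕ} (f : Fin k → Prog ℝ α) (c : ℕ), (∀ j, (f j).eval.2 ≤ c) →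
    (tab f).eval.2 ≤ k * c
  | 0, _, _, _ => by simp [tab]
  | k + 1, f, c, h => by
    have h0 := h 0
    have h1 := eval_tab_snd_le (fun j => f j.succ) c fun j => h j.succ
    simp only [tab, eval_bind, eval_pure]
    rw [Nat.succ_mul]
    omega

@[simp] theorem eval_tabT_fst {n : ℕ} : ∀ {m : ℕ} (f : (Fin m → Fin n) → Prog ℝ α),
    (tabT f).eval.1 = fun i => (f i).eval.1
  | 0, f => by
    funext i
    simp [tabT, Subsingleton.elim i Fin.elim0]
  | _ + 1, f => by
    funext i
    simp [tabT, eval_tabT_fst]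

theorem eval_tabT_snd_le {n : ℕ} : ∀ {m : ℕ} (f : (Fin m → Fin n) → Prog ℝ α) (c : ℕ),
    (∀ i, (f i).eval.2 ≤ c) → (tabT f).eval.2 ≤ n ^ m * c
  | 0, f, c, h => by simpa [tabT] using h Fin.elim0
  | m + 1, f, c, h => by
    have h1 := eval_tab_snd_le (fun j => tabT fun i : Fin m → Fin n => f (Fin.cons j i)) (n ^ m * c)
      fun j => eval_tabT_snd_le _ c fun i => h _
    simp only [tabT, eval_bind, eval_pure]
    calc _ ≤ n * (n ^ m * c) := by simpa using h1
      _ = _ := by ring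

@[simp] theorem eval_sumV : ∀ {k : ℕ} (v : Fin k → ℝ), (sumV v).eval = (∑ j, v j, k + 1)
  | 0, _ => by simp [sumV]
  | k + 1, v => by
    simp [sumV, eval_sumV, Fin.sum_univ_succ, Fin.tail]

@[simp] theorem eval_prodV : ∀ {k : ℕ} (v : Fin k → ℝ), (prodV v).eval = (∏ j, v j, k + 1)
  | 0, _ => by simp [prodV]
  | k + 1, v => by
    simp [prodV, eval_prodV, Fin.prod_univ_succ, Fin.tail]

theorem eval_maxV_snd : ∀ {k : ℕ} (v : Fin k → ℝ), (maxV v).eval.2 = k + 1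
  | 0, _ => by simp [maxV]
  | k + 1, v => by simp [maxV, eval_maxV_snd]

theorem le_eval_maxV : ∀ {k : ℕ} (v : Fin k → ℝ), 0 ≤ (maxV v).eval.1 ∧
    ∀ j, v j ≤ (maxV v).eval.1
  | 0, _ => by simp [maxV]
  | k + 1, v => by
    obtain ⟨h0, h1⟩ := le_eval_maxV (Fin.tail v)
    simp only [maxV, eval_bind, eval_maxP]
    exact ⟨le_max_of_le_right h0,
      Fin.cases (le_max_left _ _) fun j => le_max_of_le_right (h1 j)⟩

theorem eval_maxV_le : ∀ {k : ℕ} (v : Fin k → ℝ) (M : ℝ), 0 ≤ M → (∀ j, v j ≤ M) →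
    (maxV v).eval.1 ≤ M
  | 0, _, _, h, _ => by simpa [maxV] using h
  | k + 1, v, M, h, hv => by
    simp only [maxV, eval_bind, eval_maxP]
    exact max_le (hv 0) (eval_maxV_le (Fin.tail v) M h fun j => hv j.succ)

@[simp] theorem eval_normV_fst {k : ℕ} (v : Fin k → ℝ) : (normV v).eval.1 = ∑ j, |v j| := by
  simp [normV]

theorem eval_normV_snd_le {k : ℕ} (v : Fin k → ℝ) : (normV v).eval.2 ≤ 4 * k + 1 := by
  have := eval_tab_snd_le (fun j => absP (v j)) 3 (by simp)
  simp only [normV, eval_bind, eval_sumV]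
  omega

@[simp] theorem eval_sumT_fst {n : ℕ} : ∀ {m : ℕ} (A : Tensor m n ℝ),
    (sumT A).eval.1 = ∑ i, A i
  | 0, A => by
    simp only [sumT, eval_pure, Finset.univ_unique, Finset.sum_singleton]
    exact congrArg A (Subsingleton.elim _ _)
  | m + 1, A => by simp [sumT, eval_sumT_fst, sum_cons]

/-- The slack 3 makes the induction close: n(3n^m - 3) + (n + 1) + 3 = 3n^(m+1) - 2n + 4, and n ≥ 2.
The same slack works in `eval_normT_snd_le`. -/
theorem eval_sumT_snd_le {n : ℕ} (hn : 2 ≤ n) : ∀ {m : ℕ} (A : Tensor m n ℝ),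
    (sumT A).eval.2 + 3 ≤ 3 * n ^ m
  | 0, A => by simp [sumT]
  | m + 1, A => by
    have h1 := eval_tab_snd_le (fun j => sumT fun i : Fin m → Fin n => A (Fin.cons j i))
      (3 * n ^ m - 3) fun j => Nat.le_sub_of_add_le (eval_sumT_snd_le hn _)
    simp only [sumT, eval_bind, eval_sumV]
    have h2 : 1 ≤ n ^ m := Nat.one_le_pow _ _ (by omega)
    obtain ⟨q, hq⟩ := Nat.exists_eq_add_of_le h2
    rw [hq] at h1
    rw [pow_succ, hq]
    have : 3 * (1 + q) - 3 = 3 * q := by omega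
    rw [this] at h1
    nlinarith

theorem eval_normT_nonneg {n : ℕ} : ∀ {m : ℕ} (A : Tensor m n ℝ), 0 ≤ (normT A).eval.1
  | 0, A => by simp [normT]
  | m + 1, A => by simpa [normT] using (le_eval_maxV _).1

theorem le_eval_normT {n : ℕ} : ∀ {m : ℕ} (A : Tensor m n ℝ) i, |A i| ≤ (normT A).eval.1
  | 0, A, i => by simp [normT, Subsingleton.elim i Fin.elim0]
  | m + 1, A, i => by
    simp only [normT, eval_bind, eval_tab_fst]
    refine le_trans ?_ ((le_eval_maxV _).2 (i 0))
    simpa using le_eval_normT (fun i' => A (Fin.cons (i 0) i')) (Fin.tail i)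

theorem eval_normT_le {n : ℕ} : ∀ {m : ℕ} (A : Tensor m n ℝ) (M : ℝ), 0 ≤ M →
    (∀ i, |A i| ≤ M) → (normT A).eval.1 ≤ M
  | 0, A, M, _, h => by simpa [normT] using h Fin.elim0
  | m + 1, A, M, hM, h => by
    simp only [normT, eval_bind, eval_tab_fst]
    exact eval_maxV_le _ M hM fun j => eval_normT_le _ M hM fun i => h _

@[simp] theorem eval_normT_fst {m n : ℕ} (A : Tensor m n ℝ) : (normT A).eval.1 = ‖A‖ :=
  le_antisymm (eval_normT_le A _ (norm_nonneg A) fun i => norm_le_pi_norm A i)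
    ((pi_norm_le_iff_of_nonneg (eval_normT_nonneg A)).2 (le_eval_normT A))

theorem eval_normT_snd_le {n : ℕ} (hn : 2 ≤ n) : ∀ {m : ℕ} (A : Tensor m n ℝ),
    (normT A).eval.2 + 3 ≤ 6 * n ^ m
  | 0, A => by simp [normT]
  | m + 1, A => by
    have h1 := eval_tab_snd_le (fun j => normT fun i : Fin m → Fin n => A (Fin.cons j i))
      (6 * n ^ m - 3) fun j => Nat.le_sub_of_add_le (eval_normT_snd_le hn _)
    simp only [normT, eval_bind, eval_maxV_snd]
    have h2 : 1 ≤ n ^ m := Nat.one_le_pow _ _ (by omega)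
    obtain ⟨q, hq⟩ := Nat.exists_eq_add_of_le h2
    rw [hq] at h1
    rw [pow_succ, hq]
    have : 6 * (1 + q) - 3 = 6 * q + 3 := by omega
    rw [this] at h1
    nlinarith

@[simp] theorem eval_marginals_fst {n : ℕ} : ∀ {m : ℕ} (A : Tensor m n ℝ),
    (marginals A).eval.1 = fun k => marginal k A
  | 0, _ => funext fun k => k.elim0
  | m + 1, A => by
    funext k
    simp only [marginals, eval_bind, eval_pure, eval_tab_fst, eval_tabT_fst, eval_sumT_fst,
      eval_sumV, eval_marginals_fst]
    refine Fin.cases ?_ (fun k => ?_) k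
    · funext j
      simp [marginal_zero]
    · simp [marginal_succ]

/-- Two passes of cost O(n^(m+1)) are followed by a recursive call on a tensor n times smaller. The
geometric series removes any factor m: 4n^(m+1) + 11n^m ≤ 10n^(m+1) for n ≥ 2. -/
theorem eval_marginals_snd_le {n : ℕ} (hn : 2 ≤ n) : ∀ {m : ℕ} (A : Tensor m n ℝ),
    (marginals A).eval.2 ≤ 10 * n ^ m
  | 0, _ => by simp [marginals]
  | m + 1, A => by
    have h1 := eval_tab_snd_le (fun j => sumT fun i : Fin m → Fin n => A (Fin.cons j i))
      (3 * n ^ m) fun j => le_trans (Nat.le_add_right _ 3) (eval_sumT_snd_le hn _)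
    have h2 := eval_tabT_snd_le (fun i : Fin m → Fin n => sumV fun j => A (Fin.cons j i))
      (n + 1) fun i => by simp
    have h3 := eval_marginals_snd_le hn (tabT fun i : Fin m → Fin n =>
      sumV fun j => A (Fin.cons j i)).eval.1
    simp only [marginals, eval_bind, eval_pure]
    have h4 : n ^ m * 2 ≤ n ^ m * n := Nat.mul_le_mul_left _ hn
    rw [pow_succ]
    nlinarith

theorem eval_argmax_aux {m : ℕ} (v : Fin m → ℝ) (L : List (Fin m)) (K₀ : Fin m) :
    let p := (L.foldlM (fun K k => do
      let b ← less (v K) (v k)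
      return if b then k else K) K₀ : Prog ℝ (Fin m)).eval
    v K₀ ≤ v p.1 ∧ (∀ k ∈ L, v k ≤ v p.1) ∧ p.2 = L.length := by
  induction L generalizing K₀ with
  | nil => simp
  | cons k L ih =>
    by_cases h : v K₀ < v k
    · obtain ⟨h1, h2, h3⟩ := ih k
      simp only [List.foldlM_cons, eval_bind, eval_less, eval_pure, h, decide_true, if_true]
      refine ⟨h.le.trans h1, ?_, ?_⟩
      · simpa using ⟨h1, h2⟩
      · simp only [h3, List.length_cons]; omega
    · obtain ⟨h1, h2, h3⟩ := ih K₀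
      simp only [List.foldlM_cons, eval_bind, eval_less, eval_pure, h, decide_false,
        Bool.false_eq_true, if_false]
      refine ⟨h1, ?_, ?_⟩
      · simpa using ⟨(not_lt.1 h).trans h1, h2⟩
      · simp only [h3, List.length_cons]; omega

theorem le_eval_argmax {m : ℕ} [NeZero m] (v : Fin m → ℝ) (k : Fin m) :
    v k ≤ v (argmax v).eval.1 :=
  (eval_argmax_aux v (List.finRange m) 0).2.1 k (List.mem_finRange k)

@[simp] theorem eval_argmax_snd {m : ℕ} [NeZero m] (v : Fin m → ℝ) :
    (argmax v).eval.2 = m :=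
  (eval_argmax_aux v (List.finRange m) 0).2.2.trans List.length_finRange

@[simp] theorem eval_rhoP_fst {n : ℕ} (a b : Fin n → ℝ) : (rhoP a b).eval.1 = rho a b := by
  simp [rhoP, rho]

theorem eval_rhoP_snd_le {n : ℕ} (a b : Fin n → ℝ) : (rhoP a b).eval.2 ≤ 6 * n + 3 := by
  have h1 := eval_tab_snd_le (fun j => sub (b j) (a j)) 1 (by simp)
  have h2 := eval_tab_snd_le (fun j => (do
    let q ← div (a j) (b j)
    let l ← log q
    mul (a j) l : Prog ℝ ℝ)) 3 (by simp)
  simp only [rhoP, eval_bind, eval_sumV, eval_add]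
  omega

end Eval

end Prog

/-! ### Marginals -/

section Marginals

variable {m n : ℕ}

theorem sum_mul_marginal (k : Fin m) (A : Tensor m n ℝ) (f : Fin n → ℝ) :
    ∑ j, f j * marginal k A j = ∑ i, f (i k) * A i := by
  rw [← Finset.sum_fiberwise Finset.univ (fun i : Fin m → Fin n => i k) fun i => f (i k) * A i]
  refine Finset.sum_congr rfl fun j _ => ?_
  rw [marginal, Finset.mul_sum]
  refine Finset.sum_congr rfl fun i hi => ?_
  rw [(Finset.mem_filter.1 hi).2]

theorem sum_marginal (k : Fin m) (A : Tensor m n ℝ) : ∑ j, marginal k A j = ∑ i, A i := by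
  simpa using sum_mul_marginal k A 1

theorem marginal_nonneg {A : Tensor m n ℝ} (hA : ∀ i, 0 ≤ A i) (k : Fin m) (j : Fin n) :
    0 ≤ marginal k A j :=
  Finset.sum_nonneg fun i _ => hA i

theorem marginal_pos {A : Tensor m n ℝ} (hA : ∀ i, 0 < A i) (k : Fin m) (j : Fin n) :
    0 < marginal k A j :=
  Finset.sum_pos (fun i _ => hA i) ⟨fun _ => j, by simp⟩

theorem marginal_mono {A B : Tensor m n ℝ} (h : ∀ i, A i ≤ B i) (k : Fin m) (j : Fin n) :
    marginal k A j ≤ marginal k B j :=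
  Finset.sum_le_sum fun i _ => h i

theorem marginal_comp_mul (k : Fin m) (f : Fin n → ℝ) (A : Tensor m n ℝ) (j : Fin n) :
    marginal k (fun i => f (i k) * A i) j = f j * marginal k A j := by
  rw [marginal, marginal, Finset.mul_sum]
  refine Finset.sum_congr rfl fun i hi => ?_
  rw [(Finset.mem_filter.1 hi).2]

/-- Marginal entries at different positions are sums over the same slice. -/
theorem marginal_eq_sum_update (K : Fin m) (A : Tensor m n ℝ) (j l : Fin n) :
    marginal K A j = ∑ i : Fin m → Fin n with i K = l, A (Function.update i K j) := by
  refine Finset.sum_nbij' (fun i => Function.update i K l) (fun i => Function.update i K j)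
    ?_ ?_ ?_ ?_ ?_
  · simp
  · simp
  · intro i hi
    simp [← (Finset.mem_filter.1 hi).2]
  · intro i hi
    simp [← (Finset.mem_filter.1 hi).2]
  · intro i hi
    simp [← (Finset.mem_filter.1 hi).2]

end Marginals

/-! ### The divergence `ρ` -/

/-- Hellinger distance is below relative entropy: multiply log(√b/√a) ≤ √b/√a - 1 by 2a. -/
theorem sq_sqrt_sub_sqrt_le {a b : ℝ} (ha : 0 < a) (hb : 0 < b) :
    (√a - √b) ^ 2 ≤ b - a + a * Real.log (a / b) := by
  have h1 : 0 < √a := Real.sqrt_pos.2 ha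
  have h2 : 0 < √b := Real.sqrt_pos.2 hb
  have h := Real.log_le_sub_one_of_pos (div_pos h2 h1)
  rw [Real.log_div h2.ne' h1.ne', Real.log_sqrt ha.le, Real.log_sqrt hb.le] at h
  rw [Real.log_div ha.ne' hb.ne']
  have e1 : √a ^ 2 = a := Real.sq_sqrt ha.le
  have e2 : √b ^ 2 = b := Real.sq_sqrt hb.le
  have h3 : a * (√b / √a) = √a * √b := by
    rw [← e1, Real.sqrt_sq h1.le]; field_simp
  nlinarith [mul_le_mul_of_nonneg_left h ha.le]

/-- A form of Pinsker's inequality. -/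
theorem sq_sum_abs_sub_le_rho {n : ℕ} {a b : Fin n → ℝ} (ha : ∀ j, 0 < a j) (hb : ∀ j, 0 < b j)
    (sa : ∑ j, a j = 1) (sb : ∑ j, b j = 1) :
    (∑ j, |b j - a j|) ^ 2 ≤ 4 * rho a b := by
  have h1 : ∑ j, (√(a j) - √(b j)) ^ 2 ≤ rho a b := by
    rw [rho, ← Finset.sum_add_distrib]
    exact Finset.sum_le_sum fun j _ => sq_sqrt_sub_sqrt_le (ha j) (hb j)
  have h2 : ∑ j, (√(a j) + √(b j)) ^ 2 ≤ 4 := by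
    calc _ ≤ ∑ j, (2 * a j + 2 * b j) := Finset.sum_le_sum fun j _ => by
          nlinarith [Real.sq_sqrt (ha j).le, Real.sq_sqrt (hb j).le, sq_nonneg (√(a j) - √(b j))]
      _ = 4 := by rw [Finset.sum_add_distrib, ← Finset.mul_sum, ← Finset.mul_sum, sa, sb]; norm_num
  -- Factoring the difference through square roots prepares Cauchy–Schwarz; the second factor
  -- contributes the constant 4.
  have h3 : ∀ j, |b j - a j| = |√(a j) - √(b j)| * (√(a j) + √(b j)) := fun j => by
    have : 0 ≤ √(a j) + √(b j) := by positivity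
    rw [abs_sub_comm, show a j - b j = (√(a j) - √(b j)) * (√(a j) + √(b j)) by
      nlinarith [Real.sq_sqrt (ha j).le, Real.sq_sqrt (hb j).le], abs_mul, abs_of_nonneg this]
  calc _ = (∑ j, |√(a j) - √(b j)| * (√(a j) + √(b j))) ^ 2 := by simp only [h3]
    _ ≤ (∑ j, |√(a j) - √(b j)| ^ 2) * ∑ j, (√(a j) + √(b j)) ^ 2 :=
        Finset.sum_mul_sq_le_sq_mul_sq _ _ _
    _ ≤ rho a b * 4 := by
        simp only [sq_abs]
        exact mul_le_mul h1 h2 (Finset.sum_nonneg fun j _ => sq_nonneg _)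
          ((Finset.sum_nonneg fun j _ => sq_nonneg _).trans h1)
    _ = _ := mul_comm _ _

/-! ### Sinkhorn updates and the dual objective -/

section Sinkhorn

variable {m n : ℕ} {C : Tensor m n ℝ} {η : ℝ} {r : Fin m → Fin n → ℝ} {β : Fin m → Fin n → ℝ}

theorem gibbs_pos (C : Tensor m n ℝ) (η : ℝ) (β : Fin m → Fin n → ℝ) (i : Fin m → Fin n) :
    0 < gibbs C η β i := Real.exp_pos _

theorem sum_update_comp (β : Fin m → Fin n → ℝ) (K : Fin m) (b : Fin n → ℝ)
    (i : Fin m → Fin n) :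
    ∑ k, Function.update β K b k (i k) = ∑ k, β k (i k) + (b (i K) - β K (i K)) := by
  rw [← sub_eq_iff_eq_add', ← Finset.sum_sub_distrib, Finset.sum_eq_single K]
  · simp
  · intro k _ hk
    simp [hk]
  · simp

theorem gibbs_sinkhornUpdate (C : Tensor m n ℝ) (η : ℝ) (r β : Fin m → Fin n → ℝ) (K : Fin m)
    (i : Fin m → Fin n) : gibbs C η (sinkhornUpdate C η r β K) i = gibbs C η β i *
      Real.exp (Real.log (r K (i K)) - Real.log (marginal K (gibbs C η β) (i K))) := by
  rw [gibbs, sinkhornUpdate, sum_update_comp, gibbs, ← Real.exp_add]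
  congr 1
  ring

theorem marginal_gibbs_sinkhornUpdate (K : Fin m) (hr : ∀ j, 0 < r K j) :
    marginal K (gibbs C η (sinkhornUpdate C η r β K)) = r K := by
  funext j
  have h : gibbs C η (sinkhornUpdate C η r β K) = fun i =>
      (r K (i K) / marginal K (gibbs C η β) (i K)) * gibbs C η β i := by
    funext i
    rw [gibbs_sinkhornUpdate, ← Real.log_div (hr _).ne' (marginal_pos (gibbs_pos C η β) _ _).ne',
      Real.exp_log (div_pos (hr _) (marginal_pos (gibbs_pos C η β) _ _)), mul_comm]
  rw [h, marginal_comp_mul K fun l => r K l / marginal K (gibbs C η β) l]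
  exact div_mul_cancel₀ _ (marginal_pos (gibbs_pos C η β) _ _).ne'

/-- The dual objective of the entropic problem. -/
def dualObj (C : Tensor m n ℝ) (η : ℝ) (r β : Fin m → Fin n → ℝ) : ℝ :=
  ∑ i, gibbs C η β i - ∑ k, ∑ j, β k j * r k j

/-- The update fits marginal K exactly, so the change of mass is the linear part of `rho` and the
change of ⟨β, r⟩ is its logarithmic part. -/
theorem dualObj_sub_sinkhornUpdate (K : Fin m) (hr : ∀ j, 0 < r K j) :
    dualObj C η r β - dualObj C η r (sinkhornUpdate C η r β K) =
      rho (r K) (marginal K (gibbs C η β)) := by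
  have h1 : ∑ i, gibbs C η (sinkhornUpdate C η r β K) i = ∑ j, r K j := by
    rw [← sum_marginal K, marginal_gibbs_sinkhornUpdate K hr]
  have h2 : ∑ k, ∑ j, sinkhornUpdate C η r β K k j * r k j - ∑ k, ∑ j, β k j * r k j =
      ∑ j, r K j * Real.log (r K j / marginal K (gibbs C η β) j) := by
    rw [← Finset.sum_sub_distrib, Finset.sum_eq_single K]
    · rw [← Finset.sum_sub_distrib]
      refine Finset.sum_congr rfl fun j _ => ?_
      rw [Real.log_div (hr j).ne' (marginal_pos (gibbs_pos C η β) _ _).ne']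
      simp only [sinkhornUpdate, Function.update_self]
      ring
    · intro k _ hk
      simp [sinkhornUpdate, hk]
    · simp
  rw [dualObj, dualObj, h1, rho, ← h2, Finset.sum_sub_distrib, sum_marginal]
  ring

/-- First-order convexity inequality, obtained entrywise from exp x ≥ 1 + x. -/
theorem dualObj_sub_le (C : Tensor m n ℝ) (η : ℝ) (r β β' : Fin m → Fin n → ℝ) :
    dualObj C η r β - dualObj C η r β' ≤
      ∑ k, ∑ j, (β k j - β' k j) * (marginal k (gibbs C η β) j - r k j) := by
  have h1 : ∀ i, gibbs C η β i - gibbs C η β' i ≤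
      ∑ k, (β k (i k) - β' k (i k)) * gibbs C η β i := fun i => by
    have h := Real.add_one_le_exp ((∑ k, β' k (i k) - C i / η) - (∑ k, β k (i k) - C i / η))
    have h2 := mul_le_mul_of_nonneg_left h (gibbs_pos C η β i).le
    rw [gibbs, ← Real.exp_add] at h2
    rw [← Finset.sum_mul, Finset.sum_sub_distrib]
    simp only [gibbs]
    rw [show (∑ k, β k (i k) - C i / η) + ((∑ k, β' k (i k) - C i / η) -
      (∑ k, β k (i k) - C i / η)) = ∑ k, β' k (i k) - C i / η by ring] at h2
    linarith
  have h2 := Finset.sum_le_sum fun i (_ : i ∈ Finset.univ) => h1 i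
  rw [Finset.sum_sub_distrib, Finset.sum_comm] at h2
  have h3 : ∀ k, ∑ j, (β k j - β' k j) * (marginal k (gibbs C η β) j - r k j) =
      ∑ i, (β k (i k) - β' k (i k)) * gibbs C η β i -
        (∑ j, β k j * r k j - ∑ j, β' k j * r k j) := fun k => by
    rw [← sum_mul_marginal k _ fun j => β k j - β' k j, ← Finset.sum_sub_distrib,
      ← Finset.sum_sub_distrib]
    exact Finset.sum_congr rfl fun j _ => by ring
  simp only [h3]
  rw [Finset.sum_sub_distrib, Finset.sum_sub_distrib, dualObj, dualObj]
  linarith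

/-- In the updated block the old β K cancels: the new value is log r minus the logarithm of a slice
sum of exp(other blocks - C/η). Two such slices differ only through C, hence by a factor of at most
exp(‖C‖/η), and log r lies in [log δ, 0]. The bound is therefore invariant along the iteration. -/
theorem sinkhornUpdate_osc_le {δ : ℝ} (hη : 0 < η) (hC : ∀ i, 0 ≤ C i) (hδ : 0 < δ)
    (hr : ∀ k j, δ ≤ r k j) (hr1 : ∀ k j, r k j ≤ 1)
    (hβ : ∀ k j l, β k j - β k l ≤ ‖C‖ / η + Real.log (1 / δ)) (K : Fin m) :
    ∀ k j l, sinkhornUpdate C η r β K k j - sinkhornUpdate C η r β K k l ≤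
      ‖C‖ / η + Real.log (1 / δ) := by
  intro k j l
  by_cases hk : k = K
  swap
  · simpa [sinkhornUpdate, hk] using hβ k j l
  subst hk
  have h1 : marginal k (gibbs C η β) l * Real.exp (β k j) ≤
      marginal k (gibbs C η β) j * Real.exp (β k l + ‖C‖ / η) := by
    rw [marginal_eq_sum_update k _ j l, marginal, Finset.sum_mul, Finset.sum_mul]
    refine Finset.sum_le_sum fun i hi => ?_
    have hi := (Finset.mem_filter.1 hi).2
    rw [gibbs, gibbs, ← Real.exp_add, ← Real.exp_add, Real.exp_le_exp]
    have h2 : ∑ k', β k' (Function.update i k j k') =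
        ∑ k', β k' (i k') + (β k j - β k l) := by
      rw [← sub_eq_iff_eq_add', ← Finset.sum_sub_distrib, Finset.sum_eq_single k]
      · simp [hi]
      · intro k' _ hk'
        simp [hk']
      · simp
    have h3 : C (Function.update i k j) / η ≤ ‖C‖ / η :=
      div_le_div_of_nonneg_right ((le_abs_self _).trans (norm_le_pi_norm C _)) hη.le
    have h4 : 0 ≤ C i / η := div_nonneg (hC i) hη.le
    rw [h2]
    linarith
  have hl := marginal_pos (gibbs_pos C η β) k l
  have hj := marginal_pos (gibbs_pos C η β) k j
  have h2 := Real.log_le_log (mul_pos hl (Real.exp_pos _)) h1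
  rw [Real.log_mul hl.ne' (Real.exp_pos _).ne', Real.log_mul hj.ne' (Real.exp_pos _).ne',
    Real.log_exp, Real.log_exp] at h2
  have h3 : Real.log (r k j) ≤ 0 := Real.log_nonpos (hδ.le.trans (hr k j)) (hr1 k j)
  have h4 : Real.log δ ≤ Real.log (r k l) := Real.log_le_log hδ (hr k l)
  simp only [sinkhornUpdate, Function.update_self, one_div, Real.log_inv]
  linarith

/-- As d sums to zero, v may be shifted by a constant, here one of its own entries. -/
theorem sum_mul_le_of_osc {v d : Fin n → ℝ} {R : ℝ} (hv : ∀ j l, v j - v l ≤ R)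
    (hd : ∑ j, d j = 0) : ∑ j, v j * d j ≤ R * ∑ j, |d j| := by
  rcases Nat.eq_zero_or_pos n with rfl | hn
  · simp
  have h : ∑ j, v j * d j = ∑ j, (v j - v ⟨0, hn⟩) * d j := by
    simp only [sub_mul, Finset.sum_sub_distrib, ← Finset.mul_sum, hd]
    ring
  rw [h, Finset.mul_sum]
  refine Finset.sum_le_sum fun j _ => (le_abs_self _).trans ?_
  rw [abs_mul]
  refine mul_le_mul_of_nonneg_right (abs_le.2 ⟨?_, hv _ _⟩) (abs_nonneg _)
  linarith [hv ⟨0, hn⟩ j]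

/-- The decrease of the dual objective controls the squared residue. -/
theorem residue_sq_le (hr : ∀ k j, 0 < r k j) (hs : ∀ k, ∑ j, r k j = 1)
    (hB : ∑ i, gibbs C η β i = 1) {K : Fin m} (hK : IsGreedy C η r β K) :
    residue C η r β ^ 2 ≤ 4 * m ^ 2 *
      (dualObj C η r β - dualObj C η r (sinkhornUpdate C η r β K)) := by
  rw [dualObj_sub_sinkhornUpdate K (hr K)]
  -- One factor m comes from Cauchy–Schwarz over the blocks, the other from bounding every block by
  -- the greedy one.
  have h1 : residue C η r β ^ 2 ≤ m * ∑ k, (∑ j, |marginal k (gibbs C η β) j - r k j|) ^ 2 := by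
    simpa [residue] using sq_sum_le_card_mul_sum_sq (s := (Finset.univ : Finset (Fin m)))
      (f := fun k => ∑ j, |marginal k (gibbs C η β) j - r k j|)
  have h2 : ∑ k, (∑ j, |marginal k (gibbs C η β) j - r k j|) ^ 2 ≤
      ∑ _k : Fin m, 4 * rho (r K) (marginal K (gibbs C η β)) :=
    Finset.sum_le_sum fun k _ => (sq_sum_abs_sub_le_rho (hr k)
      (marginal_pos (gibbs_pos C η β) k) (hs k) ((sum_marginal _ _).trans hB)).trans
      (mul_le_mul_of_nonneg_left (hK k) (by norm_num))
  rw [Finset.sum_const, Finset.card_univ, Fintype.card_fin, nsmul_eq_mul] at h2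
  refine h1.trans ((mul_le_mul_of_nonneg_left h2 (Nat.cast_nonneg m)).trans (le_of_eq ?_))
  ring

/-- Since u decreases, u_t - u_{t+1} ≥ κ u_t u_{t+1}; dividing by the product shows that 1/u grows
by at least κ per step. -/
theorem inv_ge_of_sub_ge_sq {u : ℕ → ℝ} {κ : ℝ} {T : ℕ} (hu : ∀ t ≤ T, 0 < u t) (hκ : 0 ≤ κ)
    (h : ∀ t < T, κ * u t ^ 2 ≤ u t - u (t + 1)) : T * κ ≤ (u T)⁻¹ := by
  induction T with
  | zero => simpa using hu 0 le_rfl |>.le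
  | succ T ih =>
    have h1 := ih (fun t ht => hu t (by omega)) fun t ht => h t (by omega)
    have h2 := h T (by omega)
    have p0 := hu T (by omega)
    have p1 := hu (T + 1) le_rfl
    have h3 : u (T + 1) ≤ u T := by nlinarith [mul_nonneg hκ (sq_nonneg (u T))]
    have h4 : κ ≤ (u (T + 1))⁻¹ - (u T)⁻¹ := by
      rw [inv_sub_inv p1.ne' p0.ne', le_div_iff₀ (mul_pos p1 p0)]
      nlinarith [mul_nonneg (mul_nonneg hκ p0.le) (sub_nonneg.2 h3)]
    push_cast
    linarith

/-- Number of iterations of multimarginal Sinkhorn before the residue drops to `tol`. -/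
theorem IsSinkhornSeq.iterations_le {β : ℕ → Fin m → Fin n → ℝ} (hβ : IsSinkhornSeq C η r β)
    {δ tol : ℝ} (hm : 0 < m) (hη : 0 < η) (hC : ∀ i, 0 ≤ C i) (hC0 : 0 < ‖C‖) (hδ : 0 < δ)
    (hδ1 : δ ≤ 1) (hr : ∀ k j, δ ≤ r k j) (hs : ∀ k, ∑ j, r k j = 1) (htol : 0 < tol) {T : ℕ}
    (hT : ∀ s < T, tol < residue C η r (β s)) :
    (T : ℝ) ≤ 1 + 32 * m ^ 2 * (‖C‖ / η + Real.log (1 / δ)) / tol := by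
  set R := ‖C‖ / η + Real.log (1 / δ) with hR
  have hRpos : 0 < R := by
    have : 0 ≤ Real.log (1 / δ) := Real.log_nonneg (by rw [le_div_iff₀ hδ]; linarith)
    have : 0 < ‖C‖ / η := div_pos hC0 hη
    linarith
  have hrpos : ∀ k j, 0 < r k j := fun k j => hδ.trans_le (hr k j)
  have hr1 : ∀ k j, r k j ≤ 1 := fun k j => by
    rw [← hs k]
    exact Finset.single_le_sum (fun l _ => (hrpos k l).le) (Finset.mem_univ j)
  have hosc : ∀ t, ∀ k j l, β t k j - β t k l ≤ R := by
    intro t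
    induction t with
    | zero => simpa [hβ.zero] using fun _ _ _ => hRpos.le
    | succ t ih =>
      obtain ⟨K, -, h⟩ := hβ.succ t
      rw [h]
      exact sinkhornUpdate_osc_le hη hC hδ hr hr1 ih K
  have hmass : ∀ t, ∑ i, gibbs C η (β (t + 1)) i = 1 := fun t => by
    obtain ⟨K, -, h⟩ := hβ.succ t
    rw [h, ← sum_marginal K, marginal_gibbs_sinkhornUpdate K (hrpos K), hs]
  rcases Nat.eq_zero_or_pos T with rfl | hTpos
  · have : 0 ≤ 32 * m ^ 2 * R / tol := by positivity
    simpa using by linarith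
  obtain ⟨T, rfl⟩ := Nat.exists_eq_add_of_lt hTpos
  rw [zero_add] at hT ⊢
  -- The gap is measured against the last iterate considered, so no dual minimizer is needed. The
  -- shift by one skips β 0, whose tensor need not have mass 1.
  set φ : ℕ → ℝ := fun t => dualObj C η r (β (t + 1)) - dualObj C η r (β (T + 1)) with hφ
  set E : ℕ → ℝ := fun t => residue C η r (β (t + 1)) with hE
  have hm' : (0 : ℝ) < m := Nat.cast_pos.2 hm
  have hgap : ∀ t, φ t ≤ 2 * R * E t := fun t => by
    refine (dualObj_sub_le C η r _ _).trans ?_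
    rw [hE]
    simp only [residue]
    rw [Finset.mul_sum]
    refine Finset.sum_le_sum fun k _ => ?_
    refine sum_mul_le_of_osc (v := fun j => β (t + 1) k j - β (T + 1) k j) (fun j l => ?_) ?_
    · linarith [hosc (t + 1) k j l, hosc (T + 1) k l j]
    · rw [Finset.sum_sub_distrib, sum_marginal, hmass, hs, sub_self]
  have hdec : ∀ t, E t ^ 2 ≤ 4 * m ^ 2 * (φ t - φ (t + 1)) := fun t => by
    obtain ⟨K, hK, h⟩ := hβ.succ (t + 1)
    have := residue_sq_le hrpos hs (hmass t) hK
    rw [← h] at this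
    simpa [hφ] using this
  have hanti : ∀ d t, φ (t + d) ≤ φ t := fun d t => by
    induction d with
    | zero => simp
    | succ d ih =>
      have h1 := (sq_nonneg _).trans (hdec (t + d))
      have h2 := nonneg_of_mul_nonneg_right h1 (by positivity)
      rw [← add_assoc]
      linarith
  have hφ0 : ∀ t ≤ T, 0 ≤ φ t := fun t ht => by
    have := hanti (T - t) t
    rw [Nat.add_sub_cancel' ht] at this
    simpa [hφ] using this
  -- Adding tol to the normalized gap treats large and small gaps at once: both summands are at most
  -- E t, so u_t² ≤ 4 (E t)² ≤ 16m²(φ t - φ (t+1)) = 32m²R(u_t - u_{t+1}). At the end u_T = tol.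
  have key := inv_ge_of_sub_ge_sq (u := fun t => φ t / (2 * R) + tol)
    (κ := 1 / (32 * m ^ 2 * R)) (T := T)
    (fun t ht => by have := hφ0 t ht; positivity) (by positivity) (fun t ht => by
      have h1 : φ t / (2 * R) ≤ E t := by
        rw [div_le_iff₀ (by positivity)]; linarith [hgap t]
      have h2 : tol < E t := hT (t + 1) (by omega)
      have h3 : 0 ≤ φ t / (2 * R) := by have := hφ0 t ht.le; positivity
      have h4 : (φ t / (2 * R) + tol) ^ 2 ≤ 16 * m ^ 2 * (φ t - φ (t + 1)) := by
        have h5 : (φ t / (2 * R) + tol) ^ 2 ≤ (2 * E t) ^ 2 :=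
          pow_le_pow_left₀ (by linarith) (by linarith) 2
        linarith [hdec t]
      calc 1 / (32 * m ^ 2 * R) * (φ t / (2 * R) + tol) ^ 2
          ≤ 1 / (32 * m ^ 2 * R) * (16 * m ^ 2 * (φ t - φ (t + 1))) :=
            mul_le_mul_of_nonneg_left h4 (by positivity)
        _ = _ := by field_simp; ring)
  have hφT : φ T = 0 := by simp [hφ]
  simp only [hφT, zero_div, zero_add] at key
  rw [mul_one_div, div_le_iff₀ (by positivity), inv_mul_eq_div] at key
  push_cast
  linarith

end Sinkhorn

/-! ### Rounding -/

section Rounding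

variable {m n : ℕ} {r : Fin m → Fin n → ℝ} {X : Tensor m n ℝ}

theorem scale_nonneg (hr : ∀ k j, 0 ≤ r k j) (hX : ∀ i, 0 ≤ X i) (k : Fin m)
    (i : Fin m → Fin n) : 0 ≤ scale r X k i :=
  mul_nonneg (le_min zero_le_one (div_nonneg (hr _ _) (marginal_nonneg hX _ _))) (hX i)

theorem scale_le (hX : ∀ i, 0 ≤ X i) (k : Fin m) (i : Fin m → Fin n) : scale r X k i ≤ X i :=
  mul_le_of_le_one_left (hX i) (min_le_left _ _)

theorem marginal_scale_self (hr : ∀ k j, 0 ≤ r k j) (hX : ∀ i, 0 ≤ X i) (k : Fin m)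
    (j : Fin n) : marginal k (scale r X k) j = min (marginal k X j) (r k j) := by
  refine (marginal_comp_mul k (fun l => min 1 (r k l / marginal k X l)) X j).trans ?_
  rcases (marginal_nonneg hX k j).eq_or_lt with h | h
  · rw [← h, mul_zero, min_eq_left (hr k j)]
  · rw [min_mul_of_nonneg _ _ h.le, one_mul, div_mul_cancel₀ _ h.ne']

/-- Scaling only decreases entries, so a marginal once brought below its target stays there, and the
mass removed in a step is at most the excess of that marginal in the initial tensor. -/
theorem foldl_scale_spec (hr : ∀ k j, 0 ≤ r k j) (L : List (Fin m)) :
    ∀ {X : Tensor m n ℝ}, (∀ i, 0 ≤ X i) →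
      (∀ i, 0 ≤ L.foldl (scale r) X i) ∧ (∀ i, L.foldl (scale r) X i ≤ X i) ∧
      (∀ k ∈ L, ∀ j, marginal k (L.foldl (scale r) X) j ≤ r k j) ∧
      ∑ i, X i - ∑ i, L.foldl (scale r) X i ≤
        (L.map fun k => ∑ j, max (marginal k X j - r k j) 0).sum := by
  induction L with
  | nil => intro X hX; simpa using hX
  | cons k L ih =>
    intro X hX
    obtain ⟨h1, h2, h3, h4⟩ := ih (scale_nonneg hr hX k)
    simp only [List.foldl_cons]
    refine ⟨h1, fun i => (h2 i).trans (scale_le hX k i), ?_, ?_⟩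
    · intro k' hk' j
      rcases List.mem_cons.1 hk' with rfl | hk'
      · refine (marginal_mono h2 _ j).trans ?_
        rw [marginal_scale_self hr hX]
        exact min_le_right _ _
      · exact h3 k' hk' j
    · have h5 : ∑ i, X i - ∑ i, scale r X k i = ∑ j, max (marginal k X j - r k j) 0 := by
        rw [← sum_marginal k, ← sum_marginal k, ← Finset.sum_sub_distrib]
        refine Finset.sum_congr rfl fun j _ => ?_
        rw [marginal_scale_self hr hX, ← max_sub_sub_left, sub_self, max_comm]
      have h6 : (L.map fun k' => ∑ j, max (marginal k' (scale r X k) j - r k' j) 0).sum ≤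
          (L.map fun k' => ∑ j, max (marginal k' X j - r k' j) 0).sum :=
        List.sum_le_sum fun k' _ => Finset.sum_le_sum fun j _ =>
          max_le_max_right _ (sub_le_sub_right (marginal_mono (scale_le hX k) k' j) _)
      rw [List.map_cons, List.sum_cons]
      linarith

theorem marginal_prod (e : Fin m → Fin n → ℝ) {s : ℝ} (he : ∀ k, ∑ j, e k j = s) (k : Fin m)
    (j : Fin n) : marginal k (fun i => ∏ l, e l (i l)) j = e k j * s ^ (m - 1) := by
  -- The constraint i k = j is moved into the k-th factor, so that the sum of products becomes a
  -- product of sums.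
  have h1 : marginal k (fun i => ∏ l, e l (i l)) j =
      ∑ i : Fin m → Fin n, ∏ l, if l = k ∧ i l ≠ j then 0 else e l (i l) := by
    rw [marginal_eq_ite]
    refine Finset.sum_congr rfl fun i _ => ?_
    by_cases h : i k = j
    · rw [if_pos h]
      refine Finset.prod_congr rfl fun l _ => ?_
      rw [if_neg]
      rintro ⟨rfl, h'⟩
      exact h' h
    · rw [if_neg h, Finset.prod_eq_zero (Finset.mem_univ k)]
      simp [h]
  rw [h1, ← Fintype.piFinset_univ,
    ← Finset.prod_univ_sum (fun _ => Finset.univ) fun l x => if l = k ∧ x ≠ j then 0 else e l x,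
    ← Finset.mul_prod_erase _ _ (Finset.mem_univ k)]
  congr 1
  · rw [Finset.sum_eq_single j] <;> simp +contextual
  · rw [Finset.prod_congr rfl fun l hl => ?_, Finset.prod_const,
      Finset.card_erase_of_mem (Finset.mem_univ k), Finset.card_univ, Fintype.card_fin]
    rw [← he l]
    simp [(Finset.mem_erase.1 hl).1]

theorem marginal_scaleAll_le (hr : ∀ k j, 0 ≤ r k j) (hX : ∀ i, 0 ≤ X i) (k : Fin m)
    (j : Fin n) : marginal k (scaleAll r X) j ≤ r k j :=
  (foldl_scale_spec hr _ hX).2.2.1 k (List.mem_finRange k) j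

theorem err_nonneg (hr : ∀ k j, 0 ≤ r k j) (hX : ∀ i, 0 ≤ X i) (k : Fin m) (j : Fin n) :
    0 ≤ err r X k j :=
  sub_nonneg.2 (marginal_scaleAll_le hr hX k j)

/-- The deficit is the same for every k; this lets one product tensor repair all marginals
simultaneously. -/
theorem sum_err {s : ℝ} (hs : ∀ k, ∑ j, r k j = s) (k : Fin m) :
    ∑ j, err r X k j = s - ∑ i, scaleAll r X i := by
  simp only [err]
  rw [Finset.sum_sub_distrib, hs, sum_marginal]

variable [NeZero m]

theorem sum_err_le {s : ℝ} (hr : ∀ k j, 0 ≤ r k j) (hs : ∀ k, ∑ j, r k j = s)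
    (hX : ∀ i, 0 ≤ X i) (k : Fin m) :
    ∑ j, err r X k j ≤ ∑ k, ∑ j, |marginal k X j - r k j| := by
  have h1 := (foldl_scale_spec hr (List.finRange m) hX).2.2.2
  rw [← List.ofFn_eq_map, List.sum_ofFn] at h1
  have h2 : s - ∑ i, X i = ∑ j, (r 0 j - marginal 0 X j) := by
    rw [Finset.sum_sub_distrib, hs, sum_marginal]
  have h3 : ∑ k, ∑ j, max (marginal k X j - r k j) 0 + ∑ j, (r 0 j - marginal 0 X j) ≤
      ∑ k, ∑ j, |marginal k X j - r k j| := by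
    -- Removing the positive parts from the absolute values leaves the negative parts; that of block
    -- 0 alone pays for the mass missing from X.
    rw [← le_sub_iff_add_le', ← Finset.sum_sub_distrib]
    have h4 : ∀ k, ∑ j, |marginal k X j - r k j| - ∑ j, max (marginal k X j - r k j) 0 =
        ∑ j, max (r k j - marginal k X j) 0 := fun k => by
      rw [← Finset.sum_sub_distrib]
      refine Finset.sum_congr rfl fun j _ => ?_
      rcases le_total (marginal k X j) (r k j) with h | h
      · rw [abs_of_nonpos (by linarith), max_eq_right (by linarith), max_eq_left (by linarith)]
        ring
      · rw [abs_of_nonneg (by linarith), max_eq_left (by linarith), max_eq_right (by linarith)]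
        ring
    simp only [h4]
    refine le_trans (Finset.sum_le_sum fun j _ => le_max_left _ 0)
      (Finset.single_le_sum (f := fun k => ∑ j, max (r k j - marginal k X j) 0)
        (fun k _ => Finset.sum_nonneg fun j _ => le_max_right _ _) (Finset.mem_univ 0))
  rw [sum_err hs]
  have h5 : ∑ i, scaleAll r X i = ∑ i, (List.finRange m).foldl (scale r) X i := rfl
  linarith

/-- The correction term of the rounding scheme has the missing marginals. -/
theorem marginal_correction {s : ℝ} (hr : ∀ k j, 0 ≤ r k j)
    (hs : ∀ k, ∑ j, r k j = s) (hX : ∀ i, 0 ≤ X i) (k : Fin m) (j : Fin n) :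
    marginal k (fun i => (∏ l, err r X l (i l)) / (∑ j, |err r X 0 j|) ^ (m - 1)) j =
      err r X k j := by
  have h1 : ∑ j, |err r X 0 j| = s - ∑ i, scaleAll r X i := by
    rw [← sum_err hs 0]
    exact Finset.sum_congr rfl fun j _ => abs_of_nonneg (err_nonneg hr hX 0 j)
  have h2 := marginal_prod (err r X) (sum_err (X := X) hs) k j
  rw [h1]
  simp only [div_eq_mul_inv, mul_comm _ ((s - ∑ i, scaleAll r X i) ^ (m - 1))⁻¹]
  refine (marginal_comp_mul k (fun _ => ((s - ∑ i, scaleAll r X i) ^ (m - 1))⁻¹) _ j).trans ?_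
  rw [h2]
  -- If the deficit vanishes, all errors vanish by nonnegativity, so the value given to the quotient
  -- is harmless.
  by_cases h0 : s - ∑ i, scaleAll r X i = 0
  · have h3 := sum_err (X := X) hs k
    rw [h0] at h3
    rw [(Finset.sum_eq_zero_iff_of_nonneg fun j _ => err_nonneg hr hX k j).1 h3 j
      (Finset.mem_univ j)]
    simp
  · field_simp

theorem correction_nonneg (hr : ∀ k j, 0 ≤ r k j) (hX : ∀ i, 0 ≤ X i) (i : Fin m → Fin n) :
    0 ≤ (∏ l, err r X l (i l)) / (∑ j, |err r X 0 j|) ^ (m - 1) :=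
  div_nonneg (Finset.prod_nonneg fun l _ => err_nonneg hr hX l _)
    (pow_nonneg (Finset.sum_nonneg fun _ _ => abs_nonneg _) _)

theorem isPlan_round {s : ℝ} (hr : ∀ k j, 0 ≤ r k j) (hs : ∀ k, ∑ j, r k j = s)
    (hX : ∀ i, 0 ≤ X i) : IsPlan r (round r X) := by
  refine ⟨fun i => add_nonneg ((foldl_scale_spec hr _ hX).1 i) (correction_nonneg hr hX i),
    fun k => funext fun j => ?_⟩
  have h := marginal_correction hr hs hX k j
  rw [marginal] at h
  rw [marginal]
  simp only [round]
  rw [Finset.sum_add_distrib, h, err, marginal, add_sub_cancel]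

theorem frob_round_le {C : Tensor m n ℝ} {s : ℝ} (hC : ∀ i, 0 ≤ C i)
    (hr : ∀ k j, 0 ≤ r k j) (hs : ∀ k, ∑ j, r k j = s) (hX : ∀ i, 0 ≤ X i) :
    frob C (round r X) ≤ frob C X + ‖C‖ * ∑ k, ∑ j, |marginal k X j - r k j| := by
  have h1 : ∑ i : Fin m → Fin n, (∏ l, err r X l (i l)) / (∑ j, |err r X 0 j|) ^ (m - 1) =
      ∑ j, err r X 0 j := by
    rw [← sum_marginal 0]
    exact Finset.sum_congr rfl fun j _ => marginal_correction hr hs hX 0 j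
  calc frob C (round r X)
      ≤ ∑ i, (C i * X i + ‖C‖ * ((∏ l, err r X l (i l)) / (∑ j, |err r X 0 j|) ^ (m - 1))) := by
        refine Finset.sum_le_sum fun i _ => ?_
        rw [round, mul_add]
        exact add_le_add (mul_le_mul_of_nonneg_left ((foldl_scale_spec hr _ hX).2.1 i) (hC i))
          (mul_le_mul_of_nonneg_right ((le_abs_self _).trans (norm_le_pi_norm C i))
            (correction_nonneg hr hX i))
    _ = frob C X + ‖C‖ * ∑ j, err r X 0 j := by
        rw [Finset.sum_add_distrib, ← Finset.mul_sum, h1, frob]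
    _ ≤ _ := by
        have := mul_le_mul_of_nonneg_left (sum_err_le hr hs hX 0) (norm_nonneg C)
        linarith

end Rounding

/-! ### Optimal plans and the entropic bias -/

section Plans

variable {m n : ℕ}

theorem IsPlan.sum_eq {r : Fin m → Fin n → ℝ} {X : Tensor m n ℝ} (h : IsPlan r X) (k : Fin m) :
    ∑ i, X i = ∑ j, r k j := by
  rw [← h.2 k, sum_marginal]

theorem frob_le_norm_mul_sum (C : Tensor m n ℝ) {X : Tensor m n ℝ} (hX : ∀ i, 0 ≤ X i) :
    frob C X ≤ ‖C‖ * ∑ i, X i := by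
  rw [frob, Finset.mul_sum]
  exact Finset.sum_le_sum fun i _ =>
    mul_le_mul_of_nonneg_right ((le_abs_self _).trans (norm_le_pi_norm C i)) (hX i)

theorem frob_nonneg {C X : Tensor m n ℝ} (hC : ∀ i, 0 ≤ C i) (hX : ∀ i, 0 ≤ X i) :
    0 ≤ frob C X :=
  Finset.sum_nonneg fun i _ => mul_nonneg (hC i) (hX i)

theorem exists_isOptimalPlan [NeZero m] (C : Tensor m n ℝ) {r : Fin m → Fin n → ℝ}
    (hr : ∀ k, r k ∈ stdSimplex ℝ (Fin n)) : ∃ X, IsOptimalPlan C r X := by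
  -- Rounding the zero tensor produces the product of the marginals.
  have hne : IsPlan r (round r 0) :=
    isPlan_round (fun k => (hr k).1) (fun k => (hr k).2) fun _ => le_rfl
  have hcl : IsClosed {X : Tensor m n ℝ | IsPlan r X} := by
    have : {X : Tensor m n ℝ | IsPlan r X} =
        (⋂ i, {X | 0 ≤ X i}) ∩ ⋂ k, ⋂ j, {X | marginal k X j = r k j} := by
      ext X
      simp [IsPlan, funext_iff]
    rw [this]
    refine (isClosed_iInter fun i => isClosed_le continuous_const (continuous_apply i)).inter
      (isClosed_iInter fun k => isClosed_iInter fun j => isClosed_eq ?_ continuous_const)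
    exact continuous_finsetSum _ fun i _ => continuous_apply i
  have hcpt : IsCompact {X : Tensor m n ℝ | IsPlan r X} := by
    refine (isCompact_Icc (a := (0 : Tensor m n ℝ)) (b := 1)).of_isClosed_subset hcl ?_
    intro X hX
    refine ⟨fun i => hX.1 i, fun i => ?_⟩
    rw [Pi.one_apply, ← (hr 0).2, ← hX.sum_eq 0]
    exact Finset.single_le_sum (fun i _ => hX.1 i) (Finset.mem_univ i)
  obtain ⟨X, hX, hmin⟩ := hcpt.exists_isMinOn ⟨_, hne⟩ (f := fun X => frob C X)
    (continuous_finsetSum _ fun i _ => continuous_const.mul (continuous_apply i)).continuousOn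
  exact ⟨X, hX, fun Y hY => hmin hY⟩

theorem sub_le_mul_log_sub_log {x b : ℝ} (hx : 0 ≤ x) (hb : 0 < b) :
    x - b ≤ x * (Real.log x - Real.log b) := by
  rcases hx.eq_or_lt with rfl | hx
  · simpa using hb.le
  · have h := mul_le_mul_of_nonneg_left (Real.log_le_sub_one_of_pos (div_pos hb hx)) hx.le
    rw [Real.log_div hb.ne' hx.ne', mul_sub, mul_sub, mul_div_cancel₀ _ hx.ne'] at h
    linarith

/-- Entropic bias: `B(β)` is nearly optimal among the plans with its own marginals. -/
theorem frob_gibbs_le {C : Tensor m n ℝ} {η : ℝ} (hη : 0 < η) (hm : 0 < m) (hn : 0 < n)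
    (β : Fin m → Fin n → ℝ) {X : Tensor m n ℝ}
    (hX : IsPlan (fun k => marginal k (gibbs C η β)) X) :
    frob C (gibbs C η β) ≤
      frob C X + η * ((∑ i, gibbs C η β i) * (m * Real.log n)) := by
  set B := gibbs C η β with hB
  set s := ∑ i, B i with hs
  have hXs : ∑ i, X i = s := by rw [hX.sum_eq ⟨0, hm⟩, sum_marginal]
  have hBpos : ∀ i, 0 < B i := gibbs_pos C η β
  have hspos : 0 < s := Finset.sum_pos (fun i _ => hBpos i) ⟨fun _ => ⟨0, hn⟩, Finset.mem_univ _⟩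
  have hn' : (0 : ℝ) < n := Nat.cast_pos.2 hn
  -- The potentials see only marginals, which X and B share, so they cancel in the comparison.
  have hβ : ∑ i, X i * ∑ k, β k (i k) = ∑ i, B i * ∑ k, β k (i k) := by
    simp only [Finset.mul_sum]
    rw [Finset.sum_comm, Finset.sum_comm (f := fun i k => B i * β k (i k))]
    refine Finset.sum_congr rfl fun k _ => ?_
    have h1 := sum_mul_marginal k X (β k)
    have h2 := sum_mul_marginal k B (β k)
    rw [hX.2 k] at h1
    simp only [mul_comm (β k _)] at h1 h2
    rw [← h1, ← h2]
  have hlogB : ∀ i, Real.log (B i) = ∑ k, β k (i k) - C i / η := fun i => Real.log_exp _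
  have hC : ∀ Y : Tensor m n ℝ, ∑ i, Y i * Real.log (B i) =
      ∑ i, Y i * ∑ k, β k (i k) - frob C Y / η := fun Y => by
    rw [frob, Finset.sum_div, ← Finset.sum_sub_distrib]
    refine Finset.sum_congr rfl fun i _ => ?_
    rw [hlogB]
    ring
  have h1 : ∑ i, X i * Real.log (B i) ≤ ∑ i, X i * Real.log (X i) := by
    have h := Finset.sum_le_sum fun i (_ : i ∈ Finset.univ) =>
      sub_le_mul_log_sub_log (hX.1 i) (hBpos i)
    simp only [mul_sub, Finset.sum_sub_distrib] at h
    linarith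
  have h2 : ∑ i, X i * Real.log (X i) ≤ s * Real.log s := by
    rw [← hXs, Finset.sum_mul, hXs]
    refine Finset.sum_le_sum fun i _ => ?_
    rcases (hX.1 i).eq_or_lt with h | h
    · rw [← h]; simp
    · refine mul_le_mul_of_nonneg_left (Real.log_le_log h ?_) h.le
      rw [← hXs]
      exact Finset.single_le_sum (fun i _ => hX.1 i) (Finset.mem_univ i)
  -- Gibbs' inequality against the uniform tensor of mass s.
  have h3 : s * Real.log s - s * (m * Real.log n) ≤ ∑ i, B i * Real.log (B i) := by
    have hb : 0 < s / n ^ m := by positivity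
    have h := Finset.sum_le_sum fun i (_ : i ∈ Finset.univ) =>
      sub_le_mul_log_sub_log (hBpos i).le hb
    simp only [mul_sub, Finset.sum_sub_distrib] at h
    rw [← Finset.sum_mul, Finset.sum_const, Finset.card_univ, Fintype.card_fun, Fintype.card_fin,
      Fintype.card_fin, nsmul_eq_mul, Nat.cast_pow, mul_div_cancel₀ _ (by positivity),
      Real.log_div hspos.ne' (by positivity), Real.log_pow] at h
    linarith
  rw [hC] at h1
  have h4 := hC B
  have h5 : frob C B / η ≤ frob C X / η + s * (m * Real.log n) := by linarith
  have h6 := mul_le_mul_of_nonneg_left h5 hη.le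
  rw [mul_add, mul_div_cancel₀ _ hη.ne', mul_div_cancel₀ _ hη.ne'] at h6
  exact h6

end Plans

/-! ### Correctness of the algorithm -/

section Correctness

variable {m n : ℕ} {C : Tensor m n ℝ} {r : Fin m → Fin n → ℝ} {ε : ℝ}

theorem norm_pos_of_le (hε : 0 < ε) (h : ε ≤ 32 * m * ‖C‖) : 0 < ‖C‖ := by
  by_contra h0
  have : ‖C‖ = 0 := le_antisymm (not_lt.1 h0) (norm_nonneg C)
  rw [this, mul_zero] at h
  linarith

theorem epsOf_pos (hε : 0 < ε) (h : ε ≤ 32 * m * ‖C‖) : 0 < epsOf C ε :=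
  div_pos hε (mul_pos (by norm_num) (norm_pos_of_le hε h))

theorem epsOf_div_le_one (hm : 0 < m) (hε : 0 < ε) (h : ε ≤ 32 * m * ‖C‖) :
    epsOf C ε / (4 * m) ≤ 1 := by
  have hC := norm_pos_of_le hε h
  have hm' : (0 : ℝ) < m := Nat.cast_pos.2 hm
  rw [epsOf, div_div, div_le_one (by positivity)]
  linarith

theorem le_smoothed (hr : ∀ k j, 0 ≤ r k j) (hm : 0 < m) (hε : 0 < ε)
    (h : ε ≤ 32 * m * ‖C‖) (k : Fin m) (j : Fin n) :
    epsOf C ε / (4 * m * n) ≤ smoothed C r ε k j :=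
  le_add_of_nonneg_left
    (mul_nonneg (sub_nonneg.2 (epsOf_div_le_one hm hε h)) (hr k j))

theorem sum_smoothed (hr : ∀ k, ∑ j, r k j = 1) (hn : 0 < n) (k : Fin m) :
    ∑ j, smoothed C r ε k j = 1 := by
  have hn' : (n : ℝ) ≠ 0 := Nat.cast_ne_zero.2 hn.ne'
  have hm' : (m : ℝ) ≠ 0 := Nat.cast_ne_zero.2 k.pos.ne'
  simp only [smoothed]
  rw [Finset.sum_add_distrib, ← Finset.mul_sum, hr, Finset.sum_const, Finset.card_univ,
    Fintype.card_fin, nsmul_eq_mul]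
  field_simp
  ring

theorem sum_abs_smoothed_sub_le (hr : ∀ k, r k ∈ stdSimplex ℝ (Fin n)) (hm : 0 < m) (hn : 0 < n)
    (hε : 0 ≤ epsOf C ε) :
    ∑ k, ∑ j, |smoothed C r ε k j - r k j| ≤ epsOf C ε / 2 := by
  have hm' : (0 : ℝ) < m := Nat.cast_pos.2 hm
  have hn' : (0 : ℝ) < n := Nat.cast_pos.2 hn
  have h : ∀ k, ∑ j, |smoothed C r ε k j - r k j| ≤ epsOf C ε / (4 * m) * 2 := fun k => by
    calc _ ≤ ∑ j, epsOf C ε / (4 * m) * (r k j + 1 / n) := Finset.sum_le_sum fun j _ => by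
          have e : smoothed C r ε k j - r k j = epsOf C ε / (4 * m) * (1 / n - r k j) := by
            rw [smoothed]; field_simp; ring
          rw [e, abs_mul, abs_of_nonneg (by positivity)]
          refine mul_le_mul_of_nonneg_left ?_ (by positivity)
          have h1 := (hr k).1 j
          have h2 : 0 < 1 / (n : ℝ) := by positivity
          rw [abs_le]
          constructor <;> linarith
      _ = _ := by
        rw [← Finset.mul_sum, Finset.sum_add_distrib, (hr k).2, Finset.sum_const,
          Finset.card_univ, Fintype.card_fin, nsmul_eq_mul, mul_one_div_cancel hn'.ne']
        norm_num
  refine (Finset.sum_le_sum fun k _ => h k).trans (le_of_eq ?_)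
  rw [Finset.sum_const, Finset.card_univ, Fintype.card_fin, nsmul_eq_mul]
  field_simp
  norm_num

theorem etaOf_pos (hm : 2 ≤ m) (hn : 2 ≤ n) (hε : 0 < ε) : 0 < etaOf m n ε := by
  have hm' : (0 : ℝ) < m := Nat.cast_pos.2 (by omega)
  have : 0 < Real.log n := Real.log_pos (by exact_mod_cast hn)
  exact div_pos hε (by positivity)

theorem isApproxPlan_of_returns [NeZero m] (hm : 2 ≤ m) (hn : 2 ≤ n) (hC : ∀ i, 0 ≤ C i)
    (hr : ∀ k, r k ∈ stdSimplex ℝ (Fin n)) (hε : 0 < ε) (hεC : ε ≤ 32 * m * ‖C‖)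
    {X : Tensor m n ℝ} (hX : ApproxMOTReturns C r ε X) : IsApproxPlan C r ε X := by
  obtain ⟨B, ⟨β, t, -, -, hE, rfl⟩, rfl⟩ := hX
  set B := gibbs C (etaOf m n ε) (β t) with hB
  have hCpos := norm_pos_of_le hε hεC
  have hBnn : ∀ i, 0 ≤ B i := fun i => (gibbs_pos _ _ _ i).le
  have hrnn : ∀ k j, 0 ≤ r k j := fun k => (hr k).1
  have hr1 : ∀ k, ∑ j, r k j = 1 := fun k => (hr k).2
  have hplan : IsPlan r (round r B) := isPlan_round hrnn hr1 hBnn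
  obtain ⟨Y, hY⟩ := exists_isOptimalPlan C hr
  refine ⟨hplan, Y, hY, ?_⟩
  -- For ε ≥ ‖C‖ every plan is good enough. Otherwise ε' ≤ 1/8, which keeps the mass of B below 9/8
  -- even if the loop stops at once.
  rcases le_or_gt ‖C‖ ε with hbig | hsmall
  · have h1 := frob_le_norm_mul_sum C hplan.1
    rw [hplan.sum_eq 0, hr1, mul_one] at h1
    linarith [frob_nonneg hC hY.1.1]
  set D := ∑ k, ∑ j, |marginal k B j - r k j| with hD
  have hDle : D ≤ epsOf C ε := by
    have h1 : D ≤ ∑ k, ∑ j, (|marginal k B j - smoothed C r ε k j| +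
        |smoothed C r ε k j - r k j|) :=
      Finset.sum_le_sum fun k _ => Finset.sum_le_sum fun j _ => abs_sub_le _ _ _
    simp only [Finset.sum_add_distrib] at h1
    have h2 := sum_abs_smoothed_sub_le hr (by omega) (by omega) (epsOf_pos hε hεC).le
    rw [residue, ← hB] at hE
    linarith
  have hCeps : ‖C‖ * epsOf C ε = ε / 8 := by
    rw [epsOf]; field_simp
  have hCD : ‖C‖ * D ≤ ε / 8 := hCeps ▸ mul_le_mul_of_nonneg_left hDle hCpos.le
  have heps : epsOf C ε ≤ 1 / 8 := by
    rw [epsOf, div_le_div_iff₀ (by positivity) (by norm_num)]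
    linarith
  have hs : ∑ i, B i ≤ 1 + 1 / 8 := by
    have h1 : ∑ i, B i - 1 = ∑ j, (marginal 0 B j - r 0 j) := by
      rw [Finset.sum_sub_distrib, hr1, sum_marginal]
    have h2 : ∑ j, (marginal 0 B j - r 0 j) ≤ D :=
      (Finset.sum_le_sum fun j _ => le_abs_self _).trans
        (Finset.single_le_sum (f := fun k => ∑ j, |marginal k B j - r k j|)
          (fun k _ => Finset.sum_nonneg fun j _ => abs_nonneg _) (Finset.mem_univ 0))
    linarith
  have hpnn : ∀ k j, 0 ≤ marginal k B j := fun k j => marginal_nonneg hBnn k j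
  have hps : ∀ k, ∑ j, marginal k B j = ∑ i, B i := fun k => sum_marginal k B
  have hη := etaOf_pos hm hn hε
  have h1 := frob_round_le hC hrnn hr1 hBnn
  -- The optimal plan, rounded to the marginals of B, serves as competitor in the entropic
  -- comparison. The total error is at most ε/8 + ε/8 + (9/8)(ε/2) = 13ε/16.
  have h2 := frob_round_le hC hpnn hps hY.1.1
  have h3 := frob_gibbs_le hη (by omega) (by omega) (β t)
    (isPlan_round hpnn hps hY.1.1)
  have h4 : ∑ k, ∑ j, |marginal k Y j - marginal k B j| = D :=
    Finset.sum_congr rfl fun k _ => Finset.sum_congr rfl fun j _ => by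
      rw [hY.1.2 k, abs_sub_comm]
  have h5 : etaOf m n ε * ((∑ i, B i) * (m * Real.log n)) = (∑ i, B i) * (ε / 2) := by
    have hm' : (0 : ℝ) < m := Nat.cast_pos.2 (by omega)
    have : 0 < Real.log n := Real.log_pos (by exact_mod_cast hn)
    rw [etaOf]; field_simp
  have h6 : (∑ i, B i) * (ε / 2) ≤ (1 + 1 / 8) * (ε / 2) :=
    mul_le_mul_of_nonneg_right hs (by linarith)
  rw [← hB, h5] at h3
  rw [h4] at h2
  rw [← hD] at h1
  linarith

end Correctness

namespace Prog

/-! ### The implementation -/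

section Implementation

variable {m n : ℕ}

/-- Absorbs all work on families of m vectors into the cost of one tensor pass. -/
theorem mul_le_pow (hm : 2 ≤ m) (hn : 2 ≤ n) : m * n ≤ n ^ m := by
  obtain ⟨m, rfl⟩ := Nat.exists_eq_add_of_le' (show 1 ≤ m by omega)
  rw [pow_succ]
  exact Nat.mul_le_mul_right _ (Nat.lt_pow_self hn)

/-- The loop state at the dual variables `β`. -/
def stateAt (C : Tensor m n ℝ) (η : ℝ) (r : Fin m → Fin n → ℝ) (tol : ℝ)
    (β : Fin m → Fin n → ℝ) : State m n ℝ :=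
  { rs := r, tol := tol, β := β, B := gibbs C η β }

theorem eval_initP_fst (C : Tensor m n ℝ) (r : Fin m → Fin n → ℝ) (ε : ℝ) :
    (initP C r ε).eval.1 =
      stateAt C (etaOf m n ε) (smoothed C r ε) (epsOf C ε / 2) 0 := by
  simp only [initP, stateAt, eval_bind, eval_pure, eval_num, eval_log, eval_mul, eval_div,
    eval_sub, eval_add, eval_exp, eval_tab_fst, eval_tabT_fst, eval_normT_fst]
  congr 1
  · funext k j
    simp only [smoothed, epsOf, div_div]
    push_cast
    ring
  · funext k j
    simp
  · ext i
    simp [gibbs, etaOf]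

theorem eval_initP_snd_le (hm : 2 ≤ m) (hn : 2 ≤ n) (C : Tensor m n ℝ)
    (r : Fin m → Fin n → ℝ) (ε : ℝ) : (initP C r ε).eval.2 ≤ 40 * n ^ m := by
  have h0 := mul_le_pow hm hn
  have h1 := eval_normT_snd_le hn C
  have h2 : 1 ≤ n ^ m := Nat.one_le_pow _ _ (by omega)
  have h3 (u c : ℝ) := eval_tab_snd_le (fun k => tab fun j => (do
    let x ← mul u (r k j)
    add x c : Prog ℝ ℝ)) (n * 2) fun k => eval_tab_snd_le _ 2 fun j => by simp
  have h4 (zero eta : ℝ) := eval_tabT_snd_le (fun i => (do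
    let q ← div (C i) eta
    let p ← sub zero q
    exp p : Prog ℝ ℝ)) 3 fun i => by simp
  simp only [initP, eval_bind, eval_pure, eval_num, eval_log, eval_mul, eval_div,
    eval_sub]
  grw [h3, h4]
  nlinarith

/-- Loop invariant: rescaling the stored tensor along K reproduces B(β) at the new β, so it is never
recomputed. -/
theorem eval_bodyP_fst [NeZero m] (C : Tensor m n ℝ) (η : ℝ) (r : Fin m → Fin n → ℝ) (tol : ℝ)
    (β : Fin m → Fin n → ℝ) :
    (bodyP (stateAt C η r tol β)).eval.1 = if tol < residue C η r β then
      Sum.inl (stateAt C η r tol (sinkhornUpdate C η r β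
        (argmax fun k => rho (r k) (marginal k (gibbs C η β))).eval.1))
      else Sum.inr (gibbs C η β) := by
  have hres : ∑ k, ∑ j, |marginal k (gibbs C η β) j - r k j| = residue C η r β := rfl
  by_cases h : tol < residue C η r β
  · simp only [bodyP, stateAt, eval_bind, eval_tab_fst, eval_marginals_fst, eval_normV_fst,
      eval_sub, eval_sumV, eval_less, hres, h, decide_true, if_true, eval_pure, eval_rhoP_fst,
      eval_log, eval_exp, eval_add, eval_mul, eval_tabT_fst]
    congr 2
    · simp only [sinkhornUpdate, add_sub_assoc]
    · funext i
      rw [gibbs_sinkhornUpdate]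
  · simp only [bodyP, stateAt, eval_bind, eval_tab_fst, eval_marginals_fst, eval_normV_fst,
      eval_sub, eval_sumV, eval_less, hres, h, decide_false, if_false, eval_pure,
      Bool.false_eq_true]

theorem eval_bodyP_snd_le [NeZero m] (hm : 2 ≤ m) (hn : 2 ≤ n) (s : State m n ℝ) :
    (bodyP s).eval.2 ≤ 40 * n ^ m := by
  have h0 := mul_le_pow hm hn
  have h1 := eval_marginals_snd_le hn s.B
  have h2 (q : Fin m → Fin n → ℝ) := eval_tab_snd_le (fun k => (do
      let d ← tab fun j => sub (q k j) (s.rs k j)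
      normV d : Prog ℝ ℝ)) (n * 1 + (4 * n + 1)) fun k => by
    rw [eval_bind]
    exact Nat.add_le_add (eval_tab_snd_le _ 1 fun j => by simp) (eval_normV_snd_le _)
  have h3 (q : Fin m → Fin n → ℝ) := eval_tab_snd_le (fun k => rhoP (s.rs k) (q k)) (6 * n + 3)
    fun k => eval_rhoP_snd_le _ _
  have h4 (q : Fin m → Fin n → ℝ) (K : Fin m) := eval_tab_snd_le (fun j => (do
      let x ← log (s.rs K j)
      let y ← log (q K j)
      sub x y : Prog ℝ ℝ)) 3 fun j => by simp
  have h5 (K : Fin m) (δ : Fin n → ℝ) := eval_tab_snd_le (fun j => add (s.β K j) (δ j)) 1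
    fun j => by simp
  have h6 (δ : Fin n → ℝ) := eval_tab_snd_le (fun j => exp (δ j)) 1 fun j => by simp
  have h7 (f : Fin n → ℝ) (K : Fin m) := eval_tabT_snd_le (fun i => mul (s.B i) (f (i K))) 1
    fun i => by simp
  rw [bodyP, eval_bind, eval_bind, eval_bind, eval_bind]
  simp only [eval_less, eval_sumV]
  split_ifs
  · simp only [eval_bind, eval_pure, eval_argmax_snd]
    grw [h1, h2, h3, h4, h5, h6, h7]
    nlinarith
  · simp only [eval_pure]
    grw [h1, h2]
    nlinarith

theorem eval_scale_fold [NeZero m] (hn : 2 ≤ n) (r : Fin m → Fin n → ℝ) (L : List (Fin m))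
    (X : Tensor m n ℝ) :
    let p := (L.foldlM (fun Y k => do
      let q ← marginals Y
      let z ← tab fun j => do
        let x ← div (r k j) (q k j)
        minP ((1 : ℕ) : ℝ) x
      tabT fun i => mul (z (i k)) (Y i)) X : Prog ℝ (Tensor m n ℝ)).eval
    p.1 = L.foldl (scale r) X ∧ p.2 ≤ L.length * (11 * n ^ m + 2 * n) := by
  induction L generalizing X with
  | nil => simp
  | cons k L ih =>
    simp only [List.foldlM_cons, eval_bind, List.foldl_cons, eval_tab_fst, eval_tabT_fst,
      eval_marginals_fst, eval_div, eval_minP, eval_mul, List.length_cons]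
    have hscale : (fun i => min ((1 : ℕ) : ℝ) (r k (i k) / marginal k X (i k)) * X i) =
        scale r X k := by
      funext i
      simp [scale]
    obtain ⟨h1, h2⟩ := ih (scale r X k)
    have h3 := eval_marginals_snd_le hn X
    have h4 := eval_tab_snd_le (fun j => (do
        let x ← div (r k j) (marginal k X j)
        minP ((1 : ℕ) : ℝ) x : Prog ℝ ℝ)) 2 fun j => by simp
    have h5 := eval_tabT_snd_le (fun i =>
      mul (min ((1 : ℕ) : ℝ) (r k (i k) / marginal k X (i k))) (X i)) 1 fun i => by simp
    rw [hscale]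
    refine ⟨h1, ?_⟩
    grw [h3, h4, h5, h2]
    nlinarith

theorem eval_roundP [NeZero m] (hm : 2 ≤ m) (hn : 2 ≤ n) (r : Fin m → Fin n → ℝ)
    (X : Tensor m n ℝ) :
    (roundP r X).eval.1 = round r X ∧ (roundP r X).eval.2 ≤ 40 * (m * n ^ m) := by
  obtain ⟨h1, h2⟩ := eval_scale_fold hn r (List.finRange m) X
  rw [List.length_finRange] at h2
  rw [roundP, eval_bind, eval_num]
  simp only
  rw [eval_bind, h1]
  generalize hY : (List.finRange m).foldl (scale r) X = Y
  have hY' : Y = scaleAll r X := hY.symm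
  constructor
  · simp only [eval_bind, eval_tab_fst, eval_marginals_fst, eval_tabT_fst, eval_normV_fst,
      eval_sub, eval_add, eval_div, eval_prodV]
    funext i
    subst hY'
    simp [round, err]
  · have h0 := mul_le_pow hm hn
    have h3 := eval_marginals_snd_le hn Y
    have h4 (q : Fin m → Fin n → ℝ) := eval_tab_snd_le (fun k => tab fun j => sub (r k j) (q k j))
      (n * 1) fun k => eval_tab_snd_le _ 1 fun j => by simp
    have h5 (er : Fin n → ℝ) := eval_normV_snd_le er
    have h6 (er : Fin m → Fin n → ℝ) (d : ℝ) := eval_tabT_snd_le (fun i => (do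
      let p ← prodV fun k => er k (i k)
      let x ← div p d
      add (Y i) x : Prog ℝ ℝ)) (m + 3) fun i => by simp
    simp only [eval_bind, eval_prodV]
    grw [h2, h3, h4, h5, h6]
    have h7 : m - 1 + 1 = m := by omega
    rw [h7]
    have h8 : n ^ m * 2 ≤ m * n ^ m := by rw [mul_comm]; exact Nat.mul_le_mul_right _ hm
    have h9 : 1 ≤ n ^ m := Nat.one_le_pow _ _ (by omega)
    have h10 : m * (m * n) ≤ m * n ^ m := Nat.mul_le_mul_left _ h0
    nlinarith

/-- The iterates produced by the implementation. -/
def iterates [NeZero m] (C : Tensor m n ℝ) (η : ℝ) (r : Fin m → Fin n → ℝ) :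
    ℕ → Fin m → Fin n → ℝ
  | 0 => 0
  | t + 1 => sinkhornUpdate C η r (iterates C η r t)
      (argmax fun k => rho (r k) (marginal k (gibbs C η (iterates C η r t)))).eval.1

theorem isSinkhornSeq_iterates [NeZero m] (C : Tensor m n ℝ) (η : ℝ) (r : Fin m → Fin n → ℝ) :
    IsSinkhornSeq C η r (iterates C η r) :=
  ⟨rfl, fun _ => ⟨_, fun k =>
    le_eval_argmax (fun k => rho (r k) (marginal k (gibbs C η (iterates C η r _)))) k, rfl⟩⟩

/-- Here d counts the updates still to come from iterate s; the extra pass in d + 1 is the one whose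
test ends the loop. -/
theorem exists_loopHalts [NeZero m] (hm : 2 ≤ m) (hn : 2 ≤ n) (C : Tensor m n ℝ) (η : ℝ)
    (r : Fin m → Fin n → ℝ) (tol : ℝ) (d : ℕ) :
    ∀ s, (∀ t, s ≤ t → t < s + d → tol < residue C η r (iterates C η r t)) →
      residue C η r (iterates C η r (s + d)) ≤ tol →
      ∃ N, LoopHalts bodyP (stateAt C η r tol (iterates C η r s))
        (gibbs C η (iterates C η r (s + d))) N ∧ N ≤ (d + 1) * (40 * n ^ m) := by
  induction d with
  | zero =>
    intro s _ hle
    refine ⟨_, LoopHalts.exit _ _ ?_, by simpa using eval_bodyP_snd_le hm hn _⟩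
    rw [eval_bodyP_fst, if_neg (not_lt.2 (by simpa using hle))]
    rfl
  | succ d ih =>
    intro s hlt hle
    have e : s + (d + 1) = s + 1 + d := by omega
    rw [e] at hle ⊢
    obtain ⟨N, hN, hNle⟩ := ih (s + 1) (fun t h1 h2 => hlt t (by omega) (by omega)) hle
    refine ⟨_, LoopHalts.again _ _ _ N ?_ hN, ?_⟩
    · rw [eval_bodyP_fst, if_pos (hlt s le_rfl (by omega))]
      rfl
    · have := eval_bodyP_snd_le hm hn (stateAt C η r tol (iterates C η r s))
      rw [Nat.succ_mul]
      omega

end Implementation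

end Prog

/-! ### Complexity -/

section Complexity

variable {m n : ℕ} {C : Tensor m n ℝ} {r : Fin m → Fin n → ℝ} {ε : ℝ}

theorem half_lt_log (hn : 2 ≤ n) : 1 / 2 < Real.log n := by
  have h1 : Real.log 2 ≤ Real.log n := Real.log_le_log two_pos (by exact_mod_cast hn)
  linarith [Real.log_two_gt_d9]

theorem le_complexity (hm : 2 ≤ m) (hn : 2 ≤ n) (hε : 0 < ε) (hεC : ε ≤ 32 * m * ‖C‖) :
    (m : ℝ) ≤ 2048 * ((m : ℝ) ^ 3 * ‖C‖ ^ 2 * Real.log n / ε ^ 2) := by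
  have hm' : (0 : ℝ) < m := Nat.cast_pos.2 (by omega)
  have hl := half_lt_log hn
  have h1 : ε ^ 2 ≤ (32 * m * ‖C‖) ^ 2 := pow_le_pow_left₀ hε.le hεC 2
  rw [mul_div_assoc', le_div_iff₀ (by positivity)]
  have h2 : (m : ℝ) * ε ^ 2 ≤ m * (32 * m * ‖C‖) ^ 2 := mul_le_mul_of_nonneg_left h1 hm'.le
  have h3 : 0 ≤ (m : ℝ) ^ 3 * ‖C‖ ^ 2 * (Real.log n - 1 / 2) :=
    mul_nonneg (by positivity) (by linarith)
  nlinarith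

theorem iterations_le_complexity (hm : 2 ≤ m) (hn : 2 ≤ n) (hC : ∀ i, 0 ≤ C i)
    (hr : ∀ k, r k ∈ stdSimplex ℝ (Fin n)) (hε : 0 < ε) (hεC : ε ≤ 32 * m * ‖C‖)
    {β : ℕ → Fin m → Fin n → ℝ}
    (hβ : IsSinkhornSeq C (etaOf m n ε) (smoothed C r ε) β) {T : ℕ}
    (hT : ∀ s < T, epsOf C ε / 2 < residue C (etaOf m n ε) (smoothed C r ε) (β s)) :
    (T : ℝ) ≤ 1 + 51200 * ((m : ℝ) ^ 3 * ‖C‖ ^ 2 * Real.log n / ε ^ 2) := by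
  have hm' : (0 : ℝ) < m := Nat.cast_pos.2 (by omega)
  have hn' : (1 : ℝ) ≤ n := by exact_mod_cast (show 1 ≤ n by omega)
  have hCpos := norm_pos_of_le hε hεC
  have hε' := epsOf_pos hε hεC
  have hl := half_lt_log hn
  have hδ1 : epsOf C ε / (4 * m * n) ≤ 1 := by
    rw [← div_div]
    exact div_le_one_of_le₀ ((epsOf_div_le_one (by omega) hε hεC).trans hn') (by positivity)
  have key := hβ.iterations_le (δ := epsOf C ε / (4 * m * n)) (by omega) (etaOf_pos hm hn hε) hC
    hCpos (by positivity) hδ1 (le_smoothed (fun k => (hr k).1) (by omega) hε hεC)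
    (sum_smoothed (fun k => (hr k).2) (by omega)) (half_pos hε') hT
  set y : ℝ := m * ‖C‖ / ε with hy
  have hypos : 0 < y := by positivity
  have hy1 : 1 ≤ 32 * y := by
    rw [hy, mul_div_assoc', le_div_iff₀ hε]; linarith
  have hR1 : ‖C‖ / etaOf m n ε = 2 * y * Real.log n := by
    rw [etaOf, hy]; field_simp
  have hR2 : Real.log (1 / (epsOf C ε / (4 * m * n))) = Real.log (32 * y) + Real.log n := by
    rw [← Real.log_mul (by positivity) (by positivity)]
    congr 1
    rw [epsOf, hy]; field_simp; ring
  have h1 : Real.log (32 * y) ≤ 32 * y := by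
    linarith [Real.log_le_sub_one_of_pos (show 0 < 32 * y by positivity)]
  -- With log n > 1/2 and 32y ≥ 1 the terms 2y log n, 32y and log n are at most 2, 64 and 32 times y
  -- log n.
  have h2 : ‖C‖ / etaOf m n ε + Real.log (1 / (epsOf C ε / (4 * m * n))) ≤
      100 * (y * Real.log n) := by
    rw [hR1, hR2]
    nlinarith
  refine key.trans (add_le_add le_rfl ?_)
  calc _ ≤ 32 * m ^ 2 * (100 * (y * Real.log n)) / (epsOf C ε / 2) := by gcongr
    _ = _ := by rw [epsOf, hy]; field_simp; norm_num

end Complexity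

end MOT
end

/-! ### The main theorem -/

theorem theorem4p3 :
    ∃ c : ℝ, 0 < c ∧ ∀ (m n : ℕ) [NeZero m], 2 ≤ m → 2 ≤ n →
      ∀ (C : MOT.Tensor m n ℝ) (r : Fin m → Fin n → ℝ) (ε : ℝ),
        (∀ i, 0 ≤ C i) → (∀ k, r k ∈ stdSimplex ℝ (Fin n)) →
        0 < ε → ε ≤ 32 * m * ‖C‖ →
        -- the Sinkhorn loop terminates within the claimed number of iterations, however ties
        -- are broken
        (∀ β : ℕ → Fin m → Fin n → ℝ,
          MOT.IsSinkhornSeq C (MOT.etaOf m n ε) (MOT.smoothed C r ε) β →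
          ∃ t : ℕ, MOT.residue C (MOT.etaOf m n ε) (MOT.smoothed C r ε) (β t)
              ≤ MOT.epsOf C ε / 2 ∧
            (t : ℝ) ≤ c * ((m : ℝ) ^ 3 * ‖C‖ ^ 2 * Real.log n / ε ^ 2)) ∧
        -- every output of the algorithm is an approximate plan
        (∀ X, MOT.ApproxMOTReturns C r ε X → MOT.IsApproxPlan C r ε X) ∧
        -- the implementation computes an output of the algorithm within the claimed bound
        (∃ (X : MOT.Tensor m n ℝ) (N : ℕ), MOT.Prog.ApproxMOTHalts C r ε X N ∧
          MOT.ApproxMOTReturns C r ε X ∧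
          (N : ℝ) ≤ c * ((m : ℝ) ^ 3 * (n : ℝ) ^ m * ‖C‖ ^ 2 * Real.log n / ε ^ 2)) := by
  -- The constant is 40 · 75000: 40 n^m bounds one pass, and T + 2 + m ≤ 75000 Q bounds the weighted
  -- number of passes.
  refine ⟨3000000, by norm_num, fun m n _ hm hn C r ε hC hr hε hεC => ?_⟩
  have hQ := MOT.le_complexity hm hn hε hεC
  have hm2 : (2 : ℝ) ≤ m := by exact_mod_cast hm
  set Q : ℝ := (m : ℝ) ^ 3 * ‖C‖ ^ 2 * Real.log n / ε ^ 2 with hQdef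
  have hterm : ∀ β : ℕ → Fin m → Fin n → ℝ,
      MOT.IsSinkhornSeq C (MOT.etaOf m n ε) (MOT.smoothed C r ε) β →
      ∃ t : ℕ, MOT.residue C (MOT.etaOf m n ε) (MOT.smoothed C r ε) (β t) ≤ MOT.epsOf C ε / 2 ∧
        (∀ s < t, MOT.epsOf C ε / 2 <
          MOT.residue C (MOT.etaOf m n ε) (MOT.smoothed C r ε) (β s)) ∧
        (t : ℝ) ≤ 1 + 51200 * Q := by
    intro β hβ
    have hex : ∃ t : ℕ, MOT.residue C (MOT.etaOf m n ε) (MOT.smoothed C r ε) (β t) ≤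
        MOT.epsOf C ε / 2 := by
      by_contra! h
      have h1 := MOT.iterations_le_complexity hm hn hC hr hε hεC hβ
        (T := ⌊1 + 51200 * Q⌋₊ + 1) fun s _ => h s
      have h2 := Nat.lt_floor_add_one (1 + 51200 * Q)
      push_cast at h1
      linarith
    classical
    refine ⟨Nat.find hex, Nat.find_spec hex, fun s hs => not_le.1 (Nat.find_min hex hs), ?_⟩
    exact MOT.iterations_le_complexity hm hn hC hr hε hεC hβ fun s hs =>
      not_le.1 (Nat.find_min hex hs)
  refine ⟨fun β hβ => ?_, fun X => MOT.isApproxPlan_of_returns hm hn hC hr hε hεC, ?_⟩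
  · obtain ⟨t, ht, -, htQ⟩ := hterm β hβ
    exact ⟨t, ht, by linarith⟩
  · have hseq := MOT.Prog.isSinkhornSeq_iterates C (MOT.etaOf m n ε) (MOT.smoothed C r ε)
    obtain ⟨T, hT, hmin, hTQ⟩ := hterm _ hseq
    obtain ⟨N, hN, hNle⟩ := MOT.Prog.exists_loopHalts hm hn C (MOT.etaOf m n ε)
      (MOT.smoothed C r ε) (MOT.epsOf C ε / 2) T 0 (fun t _ ht => hmin t (by omega))
      (by rwa [zero_add])
    rw [zero_add] at hN
    have hinit := MOT.Prog.eval_initP_snd_le hm hn C r ε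
    obtain ⟨hround, hround_le⟩ := MOT.Prog.eval_roundP hm hn r
      (MOT.gibbs C (MOT.etaOf m n ε)
        (MOT.Prog.iterates C (MOT.etaOf m n ε) (MOT.smoothed C r ε) T))
    refine ⟨_, _, ⟨_, N, ?_, rfl, rfl⟩, ⟨_, ⟨_, T, hseq, hmin, hT, rfl⟩, hround⟩, ?_⟩
    · rw [MOT.Prog.eval_initP_fst]
      exact hN
    · have hsum : (MOT.Prog.initP C r ε).eval.2 + N + (MOT.Prog.roundP r
          (MOT.gibbs C (MOT.etaOf m n ε)
            (MOT.Prog.iterates C (MOT.etaOf m n ε) (MOT.smoothed C r ε) T))).eval.2 ≤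
          40 * n ^ m * (T + 2 + m) := by
        calc _ ≤ 40 * n ^ m + (T + 1) * (40 * n ^ m) + 40 * (m * n ^ m) :=
              add_le_add (add_le_add hinit hNle) hround_le
          _ = _ := by ring
      have hcast : ((40 * n ^ m * (T + 2 + m) : ℕ) : ℝ) = 40 * (n : ℝ) ^ m * (T + 2 + m) := by
        push_cast
        ring
      refine (Nat.cast_le.2 hsum).trans ?_
      rw [hcast]
      have h1 : (T : ℝ) + 2 + m ≤ 75000 * Q := by linarith
      calc 40 * (n : ℝ) ^ m * (T + 2 + m) ≤ 40 * (n : ℝ) ^ m * (75000 * Q) :=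
            mul_le_mul_of_nonneg_left h1 (by positivity)
        _ = _ := by rw [hQdef]; ring
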